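/- **Setting.** A Bayesian interactive decision-making task consists of a decision space $\Pi$, a context space $\mathcal C$, an observation space $\mathcal O$, a model class $\mathcal M$, for every model $M$, decision $\pi$ and context $C$ a law of an observation $O\sim M(\pi,C)$ and of a reward $r\sim R_M(\pi,C)\in[0,1]$ with mean $\mu_M(\pi,C)$, and a prior $P$ on $\mathcal M\times\mathcal C$. A model $M$ is drawn once from $P$. In each round $t=1,\dots,T$ a context $C_t\sim P(\cdot\mid M)$ is drawn and revealed, the algorithm chooses a law $p_t$ on $\Pi$ from $C_t$ and the past contexts, decisions and observations, $\pi_t\sim p_t$ is played, and an observation $O_t$ (shown to the algorithm) and a reward $r_t$ are generated from $(M,\pi_t,C_t)$. The Bayesian regret is $$\mathcal{BR}_P(T;\{p_t\})=\mathbb E\Big[\sum_{t=1}^T\big(\max_{\pi\in\Pi}\mu_M(\pi,C_t)-r_t\big)\Big].$$ **Proposition.** There is a universal constant $c>0$ such that the following hold. 1. (Finite decision sets.) For every finite set $\Pi$ with $|\Pi|\ge 2$ and every $T\ge|\Pi|$ there is a Bayesian task with decision set $\Pi$, a single context ($|\mathcal C|=1$) and a compact Hausdorff model space, in which the observation reveals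 the reward, such that every algorithm has Bayesian regret at least $c\sqrt{|\Pi|\,T}$. 2. (Multi-armed bandits.) For all $K\ge2$ and $T\ge K$ there is a prior on the mean-reward functions $f:\{1,\dots,K\}\to[0,1]$ of the $K$-armed bandit with Bernoulli rewards (the observation is the reward) such that every algorithm has Bayesian regret at least $c\sqrt{KT}$. 3. (Tabular RL.) Consider episodic tabular MDPs with $S$ states, $K$ actions, horizon $H$, an initial state distribution, and transition kernels and reward distributions that may depend on the stage $h\in\{1,\dots,H\}$ (but do not change between episodes), for which the total reward of an episode lies in $[0,1]$ almost surely under every policy. A round is an episode, a decision is a deterministic policy mapping (state, stage) to an action, the observation is the trajectory (states, actions, rewards) and the reward is the total reward of the episode. For all $H\ge1$, $S\ge2$, $K\ge2$ and $T\ge HSK$ there is a prior on these MDPs such that every algorithm has Bayesian regret over $T$ episodes at least $c\sqrt{HSKT}$. In particular, for every algorithm there is such a task (in each of the three cases) on which its regret obeys the stated bound. -/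

import Mathlib

open MeasureTheory ProbabilityTheory

set_option linter.unusedSectionVars false

noncomputable section

namespace InteractiveDecision

/-- What happens in one round: the context and the decision, then the observation and the
reward. -/
abbrev Round (Dec Ctx Obs : Type*) := (Ctx × Dec) × (Obs × ℝ)

/-- A Bayesian interactive decision-making task with decision space `Dec`, context space `Ctx`,
observation space `Obs` and model class `Model`. `feedback (M, π, C)` is the joint law of the
observation `O ∼ M(π, C)` and of the reward `r ∼ R_M(π, C)`, which lies in `[0, 1]`; `prior` is a
law on models and contexts. -/
structure Task (Dec Ctx Obs Model : Type*) [MeasurableSpace Dec] [MeasurableSpace Ctx]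
    [MeasurableSpace Obs] [MeasurableSpace Model] where
  feedback : Kernel (Model × Dec × Ctx) (Obs × ℝ)
  markov_feedback : IsMarkovKernel feedback
  reward_mem : ∀ x, ∀ᵐ y ∂(feedback x), y.2 ∈ Set.Icc (0 : ℝ) 1
  prior : ProbabilityMeasure (Model × Ctx)

/-- An algorithm: the stochastic decision of round `t` (counted from `0`) is chosen from the
observed history of the first `t` rounds (contexts, decisions, observations) and from the
current context. -/
structure Algorithm (Dec Ctx Obs : Type*) [MeasurableSpace Dec] [MeasurableSpace Ctx]
    [MeasurableSpace Obs] where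
  policy : (t : ℕ) → Kernel ((Fin t → Ctx × Dec × Obs) × Ctx) Dec
  markov_policy : ∀ t, IsMarkovKernel (policy t)

/-- The part of the past that the agent sees. -/
def observed {Dec Ctx Obs : Type*} {t : ℕ} (h : Fin t → Round Dec Ctx Obs) :
    Fin t → Ctx × Dec × Obs :=
  fun i => ((h i).1.1, (h i).1.2, (h i).2.1)

lemma measurable_observed {Dec Ctx Obs : Type*} [MeasurableSpace Dec] [MeasurableSpace Ctx]
    [MeasurableSpace Obs] {t : ℕ} :
    Measurable (observed : (Fin t → Round Dec Ctx Obs) → (Fin t → Ctx × Dec × Obs)) := by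
  unfold observed
  fun_prop

lemma measurable_snoc {α X : Type*} [MeasurableSpace α] [MeasurableSpace X] {t : ℕ}
    {f : α → (Fin t → X)} {g : α → X} (hf : Measurable f) (hg : Measurable g) :
    Measurable (fun x => (Fin.snoc (f x) (g x) : Fin (t + 1) → X)) := by
  refine measurable_pi_lambda _ fun i => ?_
  refine Fin.lastCases ?_ (fun j => ?_) i
  · simpa using hg
  · simpa [Function.comp_def] using (measurable_pi_apply j).comp hf

namespace Task

variable {Dec Ctx Obs Model : Type*} [MeasurableSpace Dec] [MeasurableSpace Ctx]
  [MeasurableSpace Obs] [MeasurableSpace Model]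

/-- The mean reward `μ_M(π, C)`. -/
def mean (task : Task Dec Ctx Obs Model) (M : Model) (π : Dec) (C : Ctx) : ℝ :=
  ∫ y, y.2 ∂(task.feedback (M, π, C))

/-- The mean reward `max_π μ_M(π, C)` of the best decision in hindsight. -/
def bestMean (task : Task Dec Ctx Obs Model) (M : Model) (C : Ctx) : ℝ :=
  ⨆ π : Dec, task.mean M π C

/-- The observation reveals the reward. -/
def RewardObserved (task : Task Dec Ctx Obs Model) : Prop :=
  ∃ f : Obs → ℝ, Measurable f ∧ ∀ x, ∀ᵐ y ∂(task.feedback x), y.2 = f y.1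

variable [StandardBorelSpace Ctx] [Nonempty Ctx]

/-- The law of round `t` given the model and the past: the context is drawn from the prior
conditioned on the model, then the decision from the algorithm, then observation and reward from
the model. -/
def roundKernel (task : Task Dec Ctx Obs Model) (alg : Algorithm Dec Ctx Obs) (t : ℕ) :
    Kernel (Model × (Fin t → Round Dec Ctx Obs)) (Round Dec Ctx Obs) :=
  (((task.prior : Measure (Model × Ctx)).condKernel.comap Prod.fst measurable_fst) ⊗ₖ
    ((alg.policy t).comap
      (fun x : (Model × (Fin t → Round Dec Ctx Obs)) × Ctx => (observed x.1.2, x.2))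
      ((measurable_observed.comp (measurable_snd.comp measurable_fst)).prodMk measurable_snd))) ⊗ₖ
    (task.feedback.comap
      (fun x : (Model × (Fin t → Round Dec Ctx Obs)) × (Ctx × Dec) => (x.1.1, x.2.2, x.2.1))
      (by fun_prop))

/-- The joint law of the model and of the first `t` rounds: the model is drawn once from the
prior, then the rounds are played one after the other. -/
def gameLaw (task : Task Dec Ctx Obs Model) (alg : Algorithm Dec Ctx Obs) :
    (t : ℕ) → Measure (Model × (Fin t → Round Dec Ctx Obs))
  | 0 => (task.prior : Measure (Model × Ctx)).fst.map (fun M => (M, Fin.elim0))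
  | t + 1 => ((gameLaw task alg t) ⊗ₘ (task.roundKernel alg t)).map
      (fun x => (x.1.1, Fin.snoc x.1.2 x.2))

/-- The game law is a genuine probability measure. -/
lemma isProbabilityMeasure_gameLaw (task : Task Dec Ctx Obs Model)
    (alg : Algorithm Dec Ctx Obs) (t : ℕ) : IsProbabilityMeasure (task.gameLaw alg t) := by
  induction t with
  | zero =>
    exact Measure.isProbabilityMeasure_map
      (measurable_id.prodMk measurable_const).aemeasurable
  | succ t ih =>
    have := task.markov_feedback
    have := alg.markov_policy t
    have : IsMarkovKernel (task.roundKernel alg t) := by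
      unfold roundKernel
      infer_instance
    exact Measure.isProbabilityMeasure_map
      ((measurable_fst.comp measurable_fst).prodMk
        (measurable_snoc (measurable_snd.comp measurable_fst) measurable_snd)).aemeasurable

/-- The Bayesian regret `𝔼 [∑ₜ (max_π μ_M(π, Cₜ) - rₜ)]` of `alg` over `T` rounds. -/
def bayesRegret (task : Task Dec Ctx Obs Model) (alg : Algorithm Dec Ctx Obs) (T : ℕ) : ℝ :=
  ∫ x, ∑ t : Fin T, (task.bestMean x.1 (x.2 t).1.1 - (x.2 t).2.2) ∂(task.gameLaw alg T)

end Task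

/-! ### Bernoulli bandits -/

section Bandit

variable {Dec Ctx : Type*} [Finite Dec] [MeasurableSpace Dec] [MeasurableSingletonClass Dec]
  [Finite Ctx] [MeasurableSpace Ctx] [MeasurableSingletonClass Ctx]

lemma measurable_bernoulliMeasure :
    Measurable (fun p : unitInterval => bernoulliMeasure (1 : ℝ) 0 p) := by
  refine Measure.measurable_of_measurable_coe _ fun s hs => ?_
  have h : ∀ p : unitInterval, bernoulliMeasure (1 : ℝ) 0 p s =
      (unitInterval.toNNReal p : ENNReal) * s.indicator 1 (1 : ℝ) +
      (unitInterval.toNNReal (unitInterval.symm p) : ENNReal) * s.indicator 1 (0 : ℝ) := by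
    intro p
    simp [bernoulliMeasure_def, hs]
    rfl
  simp only [h]
  have h1 : Measurable unitInterval.toNNReal := unitInterval.toNNReal_continuous.measurable
  have h2 : Measurable (fun p => unitInterval.toNNReal (unitInterval.symm p)) :=
    h1.comp unitInterval.continuous_symm.measurable
  fun_prop

lemma measurable_bandit_mean :
    Measurable (fun x : ((Dec × Ctx) → unitInterval) × Dec × Ctx => x.1 x.2) :=
  measurable_from_prod_countable_left fun d => measurable_pi_apply d

/-- The observation of a Bernoulli bandit is the reward, which is Bernoulli with mean
`f (π, C)`. -/
def banditFeedback : Kernel (((Dec × Ctx) → unitInterval) × Dec × Ctx) (ℝ × ℝ) where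
  toFun x := (bernoulliMeasure (1 : ℝ) 0 (x.1 x.2)).map (fun r : ℝ => (r, r))
  measurable' := (Measure.measurable_map _ (by fun_prop)).comp
    (measurable_bernoulliMeasure.comp measurable_bandit_mean)

/-- The contextual multi-armed bandit with Bernoulli rewards: arms `Dec`, contexts `Ctx`, and the
class of all mean reward functions `f : Dec × Ctx → [0, 1]` as model class. -/
def banditTask (P : ProbabilityMeasure (((Dec × Ctx) → unitInterval) × Ctx)) :
    Task Dec Ctx ℝ ((Dec × Ctx) → unitInterval) where
  feedback := banditFeedback
  markov_feedback := ⟨fun x => by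
    change IsProbabilityMeasure ((bernoulliMeasure (1 : ℝ) 0 (x.1 x.2)).map _)
    exact Measure.isProbabilityMeasure_map (by fun_prop)⟩
  reward_mem x := by
    change ∀ᵐ y ∂((bernoulliMeasure (1 : ℝ) 0 (x.1 x.2)).map (fun r : ℝ => (r, r))), _
    rw [ae_map_iff (by fun_prop) (measurableSet_Icc.preimage measurable_snd)]
    rw [bernoulliMeasure_def, ae_add_measure_iff]
    constructor <;> refine Measure.ae_smul_measure ?_ _ <;>
      exact (ae_dirac_iff (measurableSet_Icc (a := (0 : ℝ)) (b := 1))).2 (by simp)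
  prior := P

end Bandit

/-! ### Tabular reinforcement learning -/

/-- A finite-horizon tabular MDP with states `S`, actions `A`, horizon `H`, an initial state
distribution, and transition kernels and reward distributions that may depend on the stage. -/
structure MDP (S A : Type*) (H : ℕ) [MeasurableSpace S] where
  init : ProbabilityMeasure S
  trans : Fin H → S → A → ProbabilityMeasure S
  rew : Fin H → S → A → ProbabilityMeasure unitInterval

/-- A deterministic policy. -/
abbrev Policy (S A : Type*) (H : ℕ) := S × Fin H → A

/-- A stage of an episode: the visited state, the performed action, the reward. -/
abbrev Stage (S A : Type*) := S × A × unitInterval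

namespace MDP

variable {S A : Type*} {H : ℕ} [MeasurableSpace S]

/-- The product `σ`-algebra, each set of probability measures carrying the usual `σ`-algebra,
generated by the evaluations. -/
instance : MeasurableSpace (MDP S A H) :=
  MeasurableSpace.comap (fun M : MDP S A H => (M.init, M.trans, M.rew)) inferInstance

lemma measurable_parts : Measurable (fun M : MDP S A H => (M.init, M.trans, M.rew)) :=
  comap_measurable _

variable [Finite S] [MeasurableSingletonClass S] [Finite A] [MeasurableSpace A]
  [MeasurableSingletonClass A]

/-- The law of the initial state. -/
def initKernel : Kernel (MDP S A H × Policy S A H) S where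
  toFun x := (x.1.init : Measure S)
  measurable' := measurable_subtype_coe.comp
    (measurable_fst.comp (measurable_parts.comp measurable_fst))

/-- The law of the next state after action `a` in state `s` at stage `h`. -/
def transKernel (h : Fin H) : Kernel (MDP S A H × S × A) S where
  toFun x := (x.1.trans h x.2.1 x.2.2 : Measure S)
  measurable' := measurable_subtype_coe.comp <| by
    refine measurable_from_prod_countable_left fun y => ?_
    have h1 : Measurable fun M : MDP S A H => M.trans :=
      measurable_fst.comp (measurable_snd.comp measurable_parts)
    exact (measurable_pi_apply y.2).comp ((measurable_pi_apply y.1).comp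
      ((measurable_pi_apply h).comp h1))

/-- The law of the reward of action `a` in state `s` at stage `h`. -/
def rewKernel (h : Fin H) : Kernel (MDP S A H × S × A) unitInterval where
  toFun x := (x.1.rew h x.2.1 x.2.2 : Measure unitInterval)
  measurable' := measurable_subtype_coe.comp <| by
    refine measurable_from_prod_countable_left fun y => ?_
    have h1 : Measurable fun M : MDP S A H => M.rew :=
      measurable_snd.comp (measurable_snd.comp measurable_parts)
    exact (measurable_pi_apply y.2).comp ((measurable_pi_apply y.1).comp
      ((measurable_pi_apply h).comp h1))

lemma measurable_action (h : Fin H) {n : ℕ} :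
    Measurable (fun x : (MDP S A H × Policy S A H) × ((Fin n → Stage S A) × S) =>
      x.1.2 (x.2.2, h)) := by
  have h1 : Measurable (fun y : Policy S A H × S => y.1 (y.2, h)) :=
    measurable_from_prod_countable_left fun s => measurable_pi_apply (s, h)
  exact h1.comp ((measurable_snd.comp measurable_fst).prodMk
    (measurable_snd.comp measurable_snd))

/-- Stage `h` of an episode, from the current state: the action is that of the policy, the reward
and the next state are drawn independently. -/
def stageKernel (h : Fin H) (n : ℕ) :
    Kernel ((MDP S A H × Policy S A H) × ((Fin n → Stage S A) × S)) (A × unitInterval × S) :=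
  (Kernel.deterministic (fun x => x.1.2 (x.2.2, h)) (measurable_action h)) ×ₖ
    ((rewKernel h ×ₖ transKernel h).comap (fun x => (x.1.1, x.2.2, x.1.2 (x.2.2, h)))
      ((measurable_fst.comp measurable_fst).prodMk
        ((measurable_snd.comp measurable_snd).prodMk (measurable_action h))))

/-- The law of the first `n` stages of an episode together with the state that follows. -/
def prefixKernel : (n : ℕ) → n ≤ H →
    Kernel (MDP S A H × Policy S A H) ((Fin n → Stage S A) × S)
  | 0, _ => initKernel.map (fun s => (Fin.elim0, s))
  | n + 1, hn => ((prefixKernel n (Nat.le_of_succ_le hn)) ⊗ₖ (stageKernel ⟨n, hn⟩ n)).map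
      (fun x => (Fin.snoc x.1.1 (x.1.2, x.2.1, x.2.2.1), x.2.2.2))

/-- The law of the trajectory of an episode. -/
def episodeKernel : Kernel (MDP S A H × Policy S A H) (Fin H → Stage S A) :=
  (prefixKernel H le_rfl).map Prod.fst

lemma isMarkovKernel_prefixKernel (n : ℕ) (hn : n ≤ H) :
    IsMarkovKernel (prefixKernel (S := S) (A := A) n hn) := by
  induction n with
  | zero =>
    have : IsMarkovKernel (initKernel (S := S) (A := A) (H := H)) := ⟨fun x => x.1.init.2⟩
    exact Kernel.IsMarkovKernel.map _ (measurable_const.prodMk measurable_id)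
  | succ n ih =>
    have := ih (Nat.le_of_succ_le hn)
    have : IsMarkovKernel (rewKernel (S := S) (A := A) (⟨n, hn⟩ : Fin H)) :=
      ⟨fun x => (x.1.rew _ _ _).2⟩
    have : IsMarkovKernel (transKernel (S := S) (A := A) (⟨n, hn⟩ : Fin H)) :=
      ⟨fun x => (x.1.trans _ _ _).2⟩
    have : IsMarkovKernel (stageKernel (S := S) (A := A) (⟨n, hn⟩ : Fin H) n) := by
      unfold stageKernel
      infer_instance
    refine Kernel.IsMarkovKernel.map _ (Measurable.prodMk (measurable_snoc ?_ ?_) ?_) <;> fun_prop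

lemma isMarkovKernel_episodeKernel :
    IsMarkovKernel (episodeKernel (S := S) (A := A) (H := H)) := by
  have := isMarkovKernel_prefixKernel (S := S) (A := A) H le_rfl
  exact Kernel.IsMarkovKernel.map _ measurable_fst

end MDP

/-- The total reward of an episode. -/
def totalReward {S A : Type*} {H : ℕ} (τ : Fin H → Stage S A) : ℝ :=
  ∑ h : Fin H, ((τ h).2.2 : ℝ)

section TabularRL

variable (S A : Type*) (H : ℕ) [MeasurableSpace S] [Finite S] [MeasurableSingletonClass S]
  [Finite A] [MeasurableSpace A] [MeasurableSingletonClass A]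

/-- The class of the MDPs for which the reward of every episode lies in `[0, 1]`. -/
abbrev BoundedMDP :=
  {M : MDP S A H // ∀ π : Policy S A H, ∀ᵐ τ ∂(MDP.episodeKernel (M, π)), totalReward τ ≤ 1}

variable {S A H}

lemma measurable_totalReward :
    Measurable (totalReward : (Fin H → Stage S A) → ℝ) := by
  unfold totalReward
  fun_prop

/-- Tabular reinforcement learning: a round is an episode, a decision is a deterministic policy
that is played over the whole episode, the observation is the trajectory, and the reward is the
total reward of the episode. There is a single context. -/
def tabularTask (P : ProbabilityMeasure (BoundedMDP S A H × Unit)) :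
    Task (Policy S A H) Unit (Fin H → Stage S A) (BoundedMDP S A H) where
  feedback := (MDP.episodeKernel.comap
    (fun x : BoundedMDP S A H × Policy S A H × Unit => (x.1.1, x.2.1))
    ((measurable_subtype_coe.comp measurable_fst).prodMk
      (measurable_fst.comp measurable_snd))).map (fun τ => (τ, totalReward τ))
  markov_feedback := by
    have := MDP.isMarkovKernel_episodeKernel (S := S) (A := A) (H := H)
    exact Kernel.IsMarkovKernel.map _ (measurable_id.prodMk measurable_totalReward)
  reward_mem x := by
    have hm : Measurable (fun τ : Fin H → Stage S A => (τ, totalReward τ)) :=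
      measurable_id.prodMk measurable_totalReward
    rw [Kernel.map_apply _ hm,
      ae_map_iff hm.aemeasurable (measurableSet_Icc.preimage measurable_snd)]
    filter_upwards [x.1.2 x.2.1] with τ hτ
    exact ⟨Finset.sum_nonneg fun h _ => (τ h).2.2.2.1, hτ⟩
  prior := P

end TabularRL

end InteractiveDecision

end

open InteractiveDecision

/-!
All three bounds are instances of one statement, `Task.le_bayesRegret_of_uniform`. The model is
indexed by a hidden `θ : I → A`, uniformly distributed; a decision `d` guesses all coordinates, as
`act d : I → A`, and every wrong guess costs `ρ` in mean reward. Comparing `m θ` with the model in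
which coordinate `i` is erased (`none`), the response to `d` has the same law unless
`act d i = θ i`, in which case the divergence is at most `η`. Under the erased model the guesses of
coordinate `i` do not depend on `θ i`; so, averaging over `θ i`, they are right with probability
`1 / |A|`, and by the chain rule (`Task.klDiv_histLaw_le`) the histories of `T` rounds under the two
models have divergence at most `η T / |A|` on average. If this is at most `1 / 4`, a linear change
of measure inequality (`measureReal_le_klDiv_add`) shows that coordinate `i` is guessed wrong with
probability at least `1 / 8` in every round, and the regret is at least `ρ |I| T / 8`.

For bandits, `I` is a point, one hidden arm has mean `1 / 2 + ε` and all others `1 / 2`; then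
`ρ = ε`, `η = 6 ε²`, and `ε` is of order `√(K / T)`.

For tabular MDPs with `H` stages and `m + 1` states, one state is absorbing and every stage and
every other state carries a hidden action, so `|I| = H m`. A stage is survived with probability
`1 - 1 / (2H)`, or `1 - 1 / (2H) + ε / H` if the hidden action is played; survivors are moved to a
uniformly random state, the others to the absorbing one. The only reward, `1`, is for surviving all
stages, so the value of a policy is a product over the stages of mean survival probabilities
(`MDP.lintegral_collected_hardMDP`), and a wrong action costs at least `ε / (2 H m)`
(`gap_hardMDP`). A given state is reached at a given stage with probability at most `1 / m`, and
there the divergence is at most `(ε / H)² · O(H)`; so an episode reveals at most `6 ε² / (H m)`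
nats about one hidden action (`MDP.klDiv_episodeKernel_le`). Here `ε` is of order `√(H m K / T)`.
-/

noncomputable section

open InformationTheory
open scoped ENNReal

namespace InteractiveDecision

/-! ### Kullback–Leibler divergence -/

section KL

variable {α β : Type*} {mα : MeasurableSpace α} {mβ : MeasurableSpace β}

lemma klDiv_compProd_right_eq_lintegral (μ : Measure α) [IsFiniteMeasure μ] (κ η : Kernel α β)
    [IsMarkovKernel κ] [IsMarkovKernel η] [MeasurableSpace.CountableOrCountablyGenerated α β]
    (h : ∀ x, κ x ≪ η x) :
    klDiv (μ ⊗ₘ κ) (μ ⊗ₘ η) = ∫⁻ x, klDiv (κ x) (η x) ∂μ := by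
  have hm : Measurable (fun p : α × β => κ.rnDeriv η p.1 p.2) := Kernel.measurable_rnDeriv κ η
  have hκ : η.withDensity (κ.rnDeriv η) = κ := by
    ext1 x; exact Kernel.withDensity_rnDeriv_eq (h x)
  have hd : μ ⊗ₘ κ = (μ ⊗ₘ η).withDensity (fun p => κ.rnDeriv η p.1 p.2) := by
    have : IsSFiniteKernel (η.withDensity (κ.rnDeriv η)) := by rw [hκ]; infer_instance
    rw [← Measure.compProd_withDensity hm, hκ]
  have hac : μ ⊗ₘ κ ≪ μ ⊗ₘ η := Measure.AbsolutelyContinuous.compProd_right (ae_of_all _ h)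
  have hr : (μ ⊗ₘ κ).rnDeriv (μ ⊗ₘ η) =ᵐ[μ ⊗ₘ η] fun p => κ.rnDeriv η p.1 p.2 := by
    rw [hd]; exact Measure.rnDeriv_withDensity _ hm
  rw [klDiv_eq_lintegral_klFun_of_ac hac, lintegral_congr_ae (hr.mono fun p hp => by rw [hp]),
    Measure.lintegral_compProd (by fun_prop)]
  refine lintegral_congr fun x => ?_
  rw [klDiv_eq_lintegral_klFun_of_ac (h x)]
  exact lintegral_congr_ae ((Kernel.rnDeriv_eq_rnDeriv_measure (κ := κ) (η := η) (a := x)).mono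
    fun y hy => by simp only [hy])

/-- The conditional part of the chain rule, for a pointwise bound on the divergences. -/
lemma klDiv_compProd_right_le (μ : Measure α) [IsFiniteMeasure μ] (κ η : Kernel α β)
    [IsMarkovKernel κ] [IsMarkovKernel η] [MeasurableSpace.CountableOrCountablyGenerated α β]
    {c : α → ℝ≥0∞} (hc : ∀ x, c x ≠ ∞) (h : ∀ x, klDiv (κ x) (η x) ≤ c x) :
    klDiv (μ ⊗ₘ κ) (μ ⊗ₘ η) ≤ ∫⁻ x, c x ∂μ := by
  rw [klDiv_compProd_right_eq_lintegral μ κ η fun x =>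
    (klDiv_ne_top_iff.1 (ne_top_of_le_ne_top (hc x) (h x))).1]
  exact lintegral_mono h

lemma klDiv_prod_le {μ μ' : Measure α} {ν ν' : Measure β} [IsProbabilityMeasure μ]
    [IsProbabilityMeasure μ'] [IsProbabilityMeasure ν] [IsProbabilityMeasure ν'] :
    klDiv (μ.prod ν) (μ'.prod ν') ≤ klDiv μ μ' + klDiv ν ν' := by
  -- a product is a composition with a constant kernel, and swapping the factors is harmless
  rw [← Measure.compProd_const, ← Measure.compProd_const, klDiv_compProd_eq_add]
  gcongr
  rw [Measure.compProd_const, Measure.compProd_const, ← Measure.prod_swap (μ := ν) (ν := μ),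
    ← Measure.prod_swap (μ := ν') (ν := μ)]
  refine (klDiv_map_le _ _ measurable_swap).trans ?_
  rw [← Measure.compProd_const, ← Measure.compProd_const, klDiv_compProd_left]

/-- The divergence is at most the `χ²`-divergence, since `x log x + 1 - x ≤ (x - 1)²`. -/
lemma klDiv_withDensity_le (ν : Measure α) [IsFiniteMeasure ν] {L : α → ℝ≥0∞} (hL : Measurable L)
    [IsFiniteMeasure (ν.withDensity L)] :
    klDiv (ν.withDensity L) ν ≤ ∫⁻ x, ENNReal.ofReal (((L x).toReal - 1) ^ 2) ∂ν := by
  rw [klDiv_eq_lintegral_klFun_of_ac (withDensity_absolutelyContinuous ν L)]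
  refine lintegral_mono_ae ((Measure.rnDeriv_withDensity ν hL).mono fun x hx => ?_)
  rw [hx]
  refine ENNReal.ofReal_le_ofReal ?_
  have h0 : 0 ≤ (L x).toReal := ENNReal.toReal_nonneg
  rw [klFun_apply]
  rcases h0.eq_or_lt with h | h
  · simp [← h]
  · nlinarith [Real.log_le_sub_one_of_pos h]

/-- The divergence of two laws on the same two points, through the `χ²`-divergence. -/
lemma klDiv_bernoulliMeasure_le (x y : α) (p q : unitInterval) (hq : 0 < (q : ℝ))
    (hq' : (q : ℝ) < 1) :
    klDiv (bernoulliMeasure x y p) (bernoulliMeasure x y q) ≤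
      ENNReal.ofReal (((p : ℝ) - q) ^ 2 * (1 / q + 1 / (1 - q))) := by
  have hb : Measurable (fun b : Bool => if b then x else y) := measurable_of_countable _
  have e : ∀ r, bernoulliMeasure x y r =
      (bernoulliMeasure true false r).map (fun b : Bool => if b then x else y) := fun r => by
    rw [map_bernoulliMeasure' _ _ hb]; rfl
  rw [e p, e q]
  refine (klDiv_map_le _ _ hb).trans ?_
  have h1q : 0 < 1 - (q : ℝ) := by linarith
  set L : Bool → ℝ≥0∞ := fun b => ENNReal.ofReal (if b then p / q else (1 - p) / (1 - q)) with hL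
  have hm : Measurable L := measurable_of_countable _
  have hint : ∀ f : Bool → ℝ, (∀ b, 0 ≤ f b) →
      ∫⁻ b, ENNReal.ofReal (f b) ∂(bernoulliMeasure true false q) =
        ENNReal.ofReal (q * f true + (1 - q) * f false) := fun f hf => by
    rw [← ofReal_integral_eq_lintegral_ofReal (integrable_bernoulliMeasure _ _ _ _)
      (ae_of_all _ hf), integral_bernoulliMeasure]
    rfl
  have hp := p.2.1
  have hp' := p.2.2
  have hLn : ∀ b : Bool, 0 ≤ (if b then (p : ℝ) / q else (1 - p) / (1 - q)) := by
    intro b; split_ifs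
    · positivity
    · exact div_nonneg (by linarith) h1q.le
  have hd : bernoulliMeasure true false p = (bernoulliMeasure true false q).withDensity L := by
    refine Measure.ext_of_singleton fun b => ?_
    rw [withDensity_apply _ (measurableSet_singleton b),
      ← lintegral_indicator (measurableSet_singleton b)]
    have : ∀ a, ({b} : Set Bool).indicator L a = ENNReal.ofReal
        (({b} : Set Bool).indicator
          (fun b : Bool => if b then (p : ℝ) / q else (1 - p) / (1 - q)) a) := by
      intro a
      by_cases h : a = b <;> simp [h, hL]
    simp_rw [this]
    rw [hint _ (fun a => Set.indicator_nonneg (fun c _ => hLn c) a),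
      ← ENNReal.ofReal_toReal (measure_ne_top (bernoulliMeasure true false p) {b})]
    congr 1
    change (bernoulliMeasure true false p).real {b} = _
    have h1 := hq.ne'
    have h2 := h1q.ne'
    cases b <;> simp <;> field_simp
  have : IsFiniteMeasure ((bernoulliMeasure true false q).withDensity L) := by
    rw [← hd]; infer_instance
  rw [hd]
  refine (klDiv_withDensity_le _ hm).trans ?_
  rw [hint _ fun b => sq_nonneg _]
  refine ENNReal.ofReal_le_ofReal (le_of_eq ?_)
  have hLr : ∀ b, (L b).toReal = if b then (p : ℝ) / q else (1 - p) / (1 - q) :=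
    fun b => ENNReal.toReal_ofReal (hLn b)
  simp only [hLr]
  have h1 := hq.ne'
  have h2 := h1q.ne'
  simp only [↓reduceIte, Bool.false_eq_true]
  field_simp
  ring

/-- Change of measure, from the Fenchel inequality `x ≤ (x log x + 1 - x) + (e - 1)` for the density
`x = dμ/dν`. It replaces Pinsker's inequality where only constants matter. -/
lemma measureReal_le_klDiv_add (μ ν : Measure α) [IsProbabilityMeasure μ] [IsProbabilityMeasure ν]
    {s : Set α} {k : ℝ} (hk : 0 ≤ k) (h : klDiv μ ν ≤ ENNReal.ofReal k) :
    μ.real s ≤ k + 2 * ν.real s := by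
  have hac : μ ≪ ν := (klDiv_ne_top_iff.1 (ne_top_of_le_ne_top ENNReal.ofReal_ne_top h)).1
  have key : ∀ x : ℝ, 0 ≤ x → x ≤ klFun x + 2 := fun x hx => by
    rw [klFun_apply]
    rcases hx.eq_or_lt with h | h
    · norm_num [← h]
    · -- the tangent of `x log x` at `e`
      have h1 := Real.log_le_sub_one_of_pos (div_pos (Real.exp_pos 1) h)
      rw [Real.log_div (Real.exp_pos 1).ne' h.ne', Real.log_exp] at h1
      have h2 : x * (Real.exp 1 / x - 1) = Real.exp 1 - x := by field_simp
      have h3 := Real.exp_one_lt_d9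
      nlinarith
  have h1 : μ s ≤ klDiv μ ν + 2 * ν s := by
    rw [klDiv_eq_lintegral_klFun_of_ac hac]
    calc μ s = ∫⁻ x in s, μ.rnDeriv ν x ∂ν := (Measure.setLIntegral_rnDeriv hac s).symm
      _ ≤ ∫⁻ x in s, (ENNReal.ofReal (klFun (μ.rnDeriv ν x).toReal) + 2) ∂ν := by
        refine lintegral_mono_ae (ae_restrict_of_ae ?_)
        filter_upwards [μ.rnDeriv_lt_top ν] with x hx
        calc μ.rnDeriv ν x = ENNReal.ofReal (μ.rnDeriv ν x).toReal :=
              (ENNReal.ofReal_toReal hx.ne).symm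
          _ ≤ ENNReal.ofReal (klFun (μ.rnDeriv ν x).toReal + 2) :=
              ENNReal.ofReal_le_ofReal (key _ ENNReal.toReal_nonneg)
          _ = _ := by
              rw [ENNReal.ofReal_add (klFun_nonneg ENNReal.toReal_nonneg) zero_le_two]
              simp
      _ ≤ _ := by
        rw [lintegral_add_right _ measurable_const, setLIntegral_const]
        gcongr
        exact Measure.restrict_le_self
  have h2 : μ s ≤ ENNReal.ofReal (k + 2 * ν.real s) := by
    refine h1.trans ?_
    rw [ENNReal.ofReal_add hk (by positivity), ENNReal.ofReal_mul zero_le_two]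
    gcongr
    · simp
    · rw [Measure.real, ENNReal.ofReal_toReal (measure_ne_top _ _)]
  exact ENNReal.toReal_le_of_le_ofReal (by positivity) h2

end KL

/-! ### Uniform laws -/

section Uniform

/-- The law of `f i` for a uniformly random index `i`. -/
def uniformLaw {ι X : Type*} [Fintype ι] [MeasurableSpace X] (f : ι → X) : Measure X :=
  (Fintype.card ι : ℝ≥0∞)⁻¹ • ∑ i, Measure.dirac (f i)

variable {ι X : Type*} [Fintype ι] [MeasurableSpace X]

instance [Nonempty ι] (f : ι → X) : IsProbabilityMeasure (uniformLaw f) := by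
  refine ⟨?_⟩
  simp [uniformLaw]
  exact ENNReal.inv_mul_cancel (by simp) (by simp)

lemma map_uniformLaw {Y : Type*} [MeasurableSpace Y] (f : ι → X) {g : X → Y} (hg : Measurable g) :
    (uniformLaw f).map g = uniformLaw (g ∘ f) := by
  rw [uniformLaw, uniformLaw, Measure.map_smul, ← Measure.mapₗ_apply_of_measurable hg, map_sum]
  simp [Measure.mapₗ_apply_of_measurable hg, Measure.map_dirac' hg]

/-- Averaging over all functions, one value may be resampled. -/
lemma sum_sum_update {I A : Type*} [Fintype I] [DecidableEq I] [Fintype A] (i : I)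
    (g : (I → A) → ℝ) :
    ∑ θ : I → A, ∑ a, g (Function.update θ i a) = Fintype.card A * ∑ θ, g θ := by
  -- swapping the old and the new value of the coordinate `i` is an involution
  have hinv : Function.Involutive
      (fun x : (I → A) × A => (Function.update x.1 i x.2, x.1 i)) := fun x => by simp
  rw [← Fintype.sum_prod_type' (f := fun θ a => g (Function.update θ i a)),
    ← Equiv.sum_comp (hinv.toPerm _)]
  simp [Fintype.sum_prod_type, Finset.mul_sum]

end Uniform

/-! ### Regret of a task with a uniformly random hidden index -/

namespace Task

variable {Dec Obs Model : Type*} [MeasurableSpace Dec] [MeasurableSpace Obs]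
  [MeasurableSpace Model]

/-- The law of the decision of round `t` given the past, with the only context supplied. It does not
depend on the model. -/
def decisionKernel (alg : Algorithm Dec Unit Obs) (t : ℕ) :
    Kernel (Fin t → Round Dec Unit Obs) Dec :=
  (alg.policy t).comap (fun h => (observed h, ())) (measurable_observed.prodMk measurable_const)

/-- The law of observation and reward under the model `M`, given the past and the decision. -/
def responseKernel (task : Task Dec Unit Obs Model) (M : Model) (t : ℕ) :
    Kernel ((Fin t → Round Dec Unit Obs) × Dec) (Obs × ℝ) :=
  task.feedback.comap (fun x => (M, x.2, ())) (by fun_prop)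

/-- The law of the first `t` rounds when the model is `M`. -/
def histLaw (task : Task Dec Unit Obs Model) (alg : Algorithm Dec Unit Obs) (M : Model) :
    (t : ℕ) → Measure (Fin t → Round Dec Unit Obs)
  | 0 => Measure.dirac Fin.elim0
  | t + 1 => ((histLaw task alg M t ⊗ₘ decisionKernel alg t) ⊗ₘ task.responseKernel M t).map
      (fun x => Fin.snoc x.1.1 (((), x.1.2), x.2))

/-- The law of the decision of round `t` when the model is `M`. -/
def decisionLaw (task : Task Dec Unit Obs Model) (alg : Algorithm Dec Unit Obs) (M : Model)
    (t : ℕ) : Measure Dec :=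
  decisionKernel alg t ∘ₘ task.histLaw alg M t

variable (task : Task Dec Unit Obs Model) (alg : Algorithm Dec Unit Obs) (M : Model)

instance (t : ℕ) : IsMarkovKernel (decisionKernel alg t) := by
  have := alg.markov_policy t
  unfold decisionKernel
  infer_instance

instance (t : ℕ) : IsMarkovKernel (task.responseKernel M t) := by
  have := task.markov_feedback
  unfold responseKernel
  infer_instance

lemma measurable_snoc_round (t : ℕ) : Measurable
    (fun x : ((Fin t → Round Dec Unit Obs) × Dec) × (Obs × ℝ) =>
      (Fin.snoc x.1.1 (((), x.1.2), x.2) : Fin (t + 1) → Round Dec Unit Obs)) :=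
  measurable_snoc (by fun_prop) (by fun_prop)

instance isProbabilityMeasure_histLaw (t : ℕ) : IsProbabilityMeasure (task.histLaw alg M t) := by
  induction t with
  | zero => exact Measure.dirac.isProbabilityMeasure
  | succ t ih => exact Measure.isProbabilityMeasure_map (measurable_snoc_round t).aemeasurable

instance (t : ℕ) : IsProbabilityMeasure (task.decisionLaw alg M t) := by
  unfold decisionLaw
  infer_instance

/-- With a single context, the conditional law of the context plays no role. -/
lemma lintegral_roundKernel {t : ℕ} (h : Fin t → Round Dec Unit Obs)
    {f : Round Dec Unit Obs → ℝ≥0∞} (hf : Measurable f) :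
    ∫⁻ y, f y ∂(task.roundKernel alg t (M, h)) =
      ∫⁻ d, ∫⁻ o, f (((), d), o) ∂(task.feedback (M, d, ())) ∂(decisionKernel alg t h) := by
  have := alg.markov_policy t
  have := task.markov_feedback
  rw [roundKernel, Kernel.lintegral_compProd _ _ _ hf, Kernel.lintegral_compProd]
  · simp only [Kernel.comap_apply]
    rw [lintegral_unique]
    simp [decisionKernel, Kernel.comap_apply]
  · exact (Measurable.lintegral_kernel_prod_right' (κ := task.feedback.comap
      (fun x : (Model × (Fin t → Round Dec Unit Obs)) × (Unit × Dec) => (x.1.1, x.2.2, x.2.1))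
      (by fun_prop)) (f := fun p => f (p.1.2, p.2)) (by fun_prop)).comp measurable_prodMk_left

/-- The game law is the mixture over the prior of the laws under the fixed models. -/
lemma lintegral_gameLaw {Θ : Type*} [Fintype Θ] (m : Θ → Model)
    (hm : (task.prior : Measure (Model × Unit)).fst = uniformLaw m) (t : ℕ)
    {f : Model × (Fin t → Round Dec Unit Obs) → ℝ≥0∞} (hf : Measurable f) :
    ∫⁻ x, f x ∂(task.gameLaw alg t) =
      (Fintype.card Θ : ℝ≥0∞)⁻¹ * ∑ θ, ∫⁻ h, f (m θ, h) ∂(task.histLaw alg (m θ) t) := by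
  have := alg.markov_policy t
  have := task.markov_feedback
  induction t with
  | zero =>
    have h0 : Measurable (fun M : Model => (M, (Fin.elim0 : Fin 0 → Round Dec Unit Obs))) :=
      measurable_id.prodMk measurable_const
    rw [gameLaw, lintegral_map hf h0, hm, uniformLaw, lintegral_smul_measure,
      lintegral_finsetSum_measure]
    simp only [histLaw, smul_eq_mul]
    congr 1
    refine Finset.sum_congr rfl fun θ _ => ?_
    exact (lintegral_dirac' _ (hf.comp h0)).trans
      (lintegral_dirac' _ (hf.comp measurable_prodMk_left)).symm
  | succ t ih =>
    have := alg.markov_policy t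
    have : IsMarkovKernel (task.roundKernel alg t) := by unfold roundKernel; infer_instance
    have := task.isProbabilityMeasure_gameLaw alg t
    have hs : Measurable (fun x : (Model × (Fin t → Round Dec Unit Obs)) × Round Dec Unit Obs =>
        (x.1.1, (Fin.snoc x.1.2 x.2 : Fin (t + 1) → Round Dec Unit Obs))) :=
      (measurable_fst.comp measurable_fst).prodMk
        (measurable_snoc (measurable_snd.comp measurable_fst) measurable_snd)
    have hfs := hf.comp hs
    simp only [Function.comp_def] at hfs
    rw [gameLaw, lintegral_map hf hs, Measure.lintegral_compProd hfs,
      ih (Measurable.lintegral_kernel_prod_right' hfs) (alg.markov_policy t)]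
    congr 1
    refine Finset.sum_congr rfl fun θ _ => ?_
    have hg : Measurable fun x => f (m θ, x) := hf.comp measurable_prodMk_left
    have hg' := hg.comp (measurable_snoc_round t)
    simp only [Function.comp_def] at hg'
    rw [histLaw, lintegral_map hg (measurable_snoc_round t), Measure.lintegral_compProd hg',
      Measure.lintegral_compProd (Measurable.lintegral_kernel_prod_right' hg')]
    refine lintegral_congr fun h => ?_
    exact task.lintegral_roundKernel alg (m θ) h ((hf.comp hs).comp measurable_prodMk_left)

lemma gameLaw_eq_sum {Θ : Type*} [Fintype Θ] (m : Θ → Model)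
    (hm : (task.prior : Measure (Model × Unit)).fst = uniformLaw m) (t : ℕ) :
    task.gameLaw alg t = (Fintype.card Θ : ℝ≥0∞)⁻¹ •
      ∑ θ, (task.histLaw alg (m θ) t).map (fun h => (m θ, h)) := by
  refine Measure.ext_of_lintegral _ fun f hf => ?_
  rw [task.lintegral_gameLaw alg m hm t hf, lintegral_smul_measure, lintegral_finsetSum_measure]
  simp_rw [lintegral_map hf measurable_prodMk_left]
  rfl

/-- The law of round `t` when the model is `M`. -/
def roundLaw (t : ℕ) : Measure (Round Dec Unit Obs) :=
  ((task.histLaw alg M t ⊗ₘ decisionKernel alg t) ⊗ₘ task.responseKernel M t).map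
    (fun x => (((), x.1.2), x.2))

lemma map_eval_histLaw (T t : ℕ) (ht : t < T) :
    (task.histLaw alg M T).map (fun h => h ⟨t, ht⟩) = task.roundLaw alg M t := by
  induction T with
  | zero => omega
  | succ T ih =>
    rw [histLaw, Measure.map_map (measurable_pi_apply _) (measurable_snoc_round T)]
    rcases Nat.lt_succ_iff_lt_or_eq.1 ht with h | rfl
    · rw [← ih h]
      have e : ((fun h : Fin (T + 1) → Round Dec Unit Obs => h ⟨t, ht⟩) ∘
          fun x : ((Fin T → Round Dec Unit Obs) × Dec) × (Obs × ℝ) =>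
            Fin.snoc x.1.1 (((), x.1.2), x.2)) = (fun g => g ⟨t, h⟩) ∘ Prod.fst ∘ Prod.fst := by
        funext x
        have : (⟨t, ht⟩ : Fin (T + 1)) = Fin.castSucc ⟨t, h⟩ := rfl
        simp only [Function.comp_apply, this, Fin.snoc_castSucc]
      rw [e, ← Measure.map_map (measurable_pi_apply _) (by fun_prop),
        ← Measure.map_map measurable_fst measurable_fst]
      change Measure.map _ (Measure.fst (Measure.fst _)) = _
      rw [Measure.fst_compProd, Measure.fst_compProd]
    · rw [roundLaw]
      congr 1
      funext x
      have : (⟨t, ht⟩ : Fin (t + 1)) = Fin.last t := rfl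
      simp only [Function.comp_apply, this, Fin.snoc_last]

lemma snd_histLaw_compProd (t : ℕ) :
    (task.histLaw alg M t ⊗ₘ decisionKernel alg t).snd = task.decisionLaw alg M t :=
  Measure.snd_compProd _ _

lemma integrable_reward_response (t : ℕ) : Integrable
    (fun x : ((Fin t → Round Dec Unit Obs) × Dec) × (Obs × ℝ) => x.2.2)
    ((task.histLaw alg M t ⊗ₘ decisionKernel alg t) ⊗ₘ task.responseKernel M t) := by
  refine Integrable.of_mem_Icc 0 1 (by fun_prop) ?_
  refine (Measure.ae_compProd_iff ((measurableSet_Icc).preimage (by fun_prop))).2 ?_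
  exact ae_of_all _ fun x => task.reward_mem _

lemma aestronglyMeasurable_reward (ν : Measure (Round Dec Unit Obs)) :
    AEStronglyMeasurable (fun y : Round Dec Unit Obs => y.2.2) ν :=
  (measurable_snd.comp measurable_snd).aestronglyMeasurable

lemma integrable_reward_roundLaw (t : ℕ) :
    Integrable (fun y : Round Dec Unit Obs => y.2.2) (task.roundLaw alg M t) := by
  rw [roundLaw, integrable_map_measure (aestronglyMeasurable_reward _) (by fun_prop)]
  exact task.integrable_reward_response alg M t

lemma integral_reward_roundLaw [Finite Dec] [MeasurableSingletonClass Dec] (t : ℕ) :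
    ∫ y, y.2.2 ∂(task.roundLaw alg M t) = ∫ d, task.mean M d () ∂(task.decisionLaw alg M t) := by
  rw [roundLaw, integral_map (by fun_prop) (aestronglyMeasurable_reward _),
    Measure.integral_compProd (task.integrable_reward_response alg M t),
    ← task.snd_histLaw_compProd, Measure.snd, integral_map (by fun_prop)]
  · rfl
  · exact (measurable_of_countable _).aestronglyMeasurable

/-- The regret against the model `M` is the expected sum of the gaps of the decisions. -/
lemma integral_regret_histLaw [Finite Dec] [MeasurableSingletonClass Dec] (T : ℕ) :
    Integrable (fun h : Fin T → Round Dec Unit Obs => ∑ t, (task.bestMean M () - (h t).2.2))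
      (task.histLaw alg M T) ∧
    ∫ h, ∑ t : Fin T, (task.bestMean M () - (h t).2.2) ∂(task.histLaw alg M T) =
      ∑ t : Fin T, ∫ d, (task.bestMean M () - task.mean M d ()) ∂(task.decisionLaw alg M t) := by
  have hi : ∀ t : Fin T, Integrable (fun h : Fin T → Round Dec Unit Obs =>
      task.bestMean M () - (h t).2.2) (task.histLaw alg M T) := fun t => by
    refine (integrable_const _).sub ?_
    have := task.integrable_reward_roundLaw alg M t
    rw [← task.map_eval_histLaw alg M T t t.2,
      integrable_map_measure (aestronglyMeasurable_reward _)
        (measurable_pi_apply _).aemeasurable] at this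
    exact this
  refine ⟨integrable_finsetSum _ fun t _ => hi t, ?_⟩
  rw [integral_finsetSum _ fun t _ => hi t]
  refine Finset.sum_congr rfl fun t _ => ?_
  have e : ∫ h, (task.bestMean M () - (h t).2.2) ∂(task.histLaw alg M T) =
      ∫ y, (task.bestMean M () - y.2.2) ∂(task.roundLaw alg M t) := by
    rw [← task.map_eval_histLaw alg M T t t.2]
    have hm : Measurable (fun y : Round Dec Unit Obs => task.bestMean M () - y.2.2) :=
      measurable_const.sub (measurable_snd.comp measurable_snd)
    exact (integral_map (φ := fun h : Fin T → Round Dec Unit Obs => h ⟨t, t.2⟩)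
      (measurable_pi_apply _).aemeasurable hm.aestronglyMeasurable).symm
  have : IsProbabilityMeasure (task.roundLaw alg M t) := by
    rw [← task.map_eval_histLaw alg M T t t.2]
    exact Measure.isProbabilityMeasure_map (measurable_pi_apply _).aemeasurable
  rw [e, integral_sub (integrable_const _) (task.integrable_reward_roundLaw alg M t),
    integral_sub (integrable_const _) Integrable.of_finite, integral_reward_roundLaw]
  simp

lemma measurable_bestMean [Finite Dec] [MeasurableSingletonClass Dec] :
    Measurable (fun M => task.bestMean M ()) := by
  have := task.markov_feedback
  refine Measurable.iSup fun d => ?_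
  have h : StronglyMeasurable (fun x => ∫ y, y.2 ∂(task.feedback x)) :=
    StronglyMeasurable.integral_kernel (f := fun y : Obs × ℝ => y.2)
      measurable_snd.stronglyMeasurable
  exact h.measurable.comp (by fun_prop : Measurable fun M : Model => (M, d, ()))

lemma bayesRegret_eq_sum [Finite Dec] [MeasurableSingletonClass Dec] {Θ : Type*} [Fintype Θ]
    (m : Θ → Model) (hm : (task.prior : Measure (Model × Unit)).fst = uniformLaw m) (T : ℕ) :
    task.bayesRegret alg T = (Fintype.card Θ : ℝ)⁻¹ * ∑ θ, ∑ t : Fin T,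
      ∫ d, (task.bestMean (m θ) () - task.mean (m θ) d ()) ∂(task.decisionLaw alg (m θ) t) := by
  have hF : Measurable (fun x : Model × (Fin T → Round Dec Unit Obs) =>
      ∑ t, (task.bestMean x.1 (x.2 t).1.1 - (x.2 t).2.2)) := by
    refine Finset.measurable_sum _ fun t _ => ?_
    exact (task.measurable_bestMean.comp measurable_fst).sub (by fun_prop)
  rw [bayesRegret, task.gameLaw_eq_sum alg m hm, integral_smul_measure,
    integral_finsetSum_measure]
  · rw [ENNReal.toReal_inv, ENNReal.toReal_natCast, smul_eq_mul]
    congr 1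
    refine Finset.sum_congr rfl fun θ _ => ?_
    rw [integral_map (by fun_prop) hF.aestronglyMeasurable,
      ← (task.integral_regret_histLaw alg (m θ) T).2]
  · intro θ _
    rw [integrable_map_measure hF.aestronglyMeasurable (by fun_prop)]
    exact (task.integral_regret_histLaw alg (m θ) T).1

/-- Information accumulates only through the responses to the decisions played: if the responses to
decisions outside `E` have the same law, then the divergence of the histories is at most `η` times
the expected number of decisions in `E`, under the first model. -/
lemma klDiv_histLaw_le [MeasurableSpace.CountablyGenerated Obs] (M M' : Model)
    {E : Set Dec} (hE : MeasurableSet E) {η : ℝ} (hη : 0 ≤ η)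
    (h : ∀ d, klDiv (task.feedback (M, d, ())) (task.feedback (M', d, ())) ≤
      E.indicator (fun _ => ENNReal.ofReal η) d) (t : ℕ) :
    klDiv (task.histLaw alg M t) (task.histLaw alg M' t) ≤
      ENNReal.ofReal (η * ∑ s ∈ Finset.range t, (task.decisionLaw alg M s).real E) := by
  induction t with
  | zero => simp [histLaw]
  | succ t ih =>
    rw [histLaw, histLaw]
    refine (klDiv_map_le _ _ (measurable_snoc_round t)).trans ?_
    rw [klDiv_compProd_eq_add, klDiv_compProd_left, Finset.sum_range_succ, mul_add,
      ENNReal.ofReal_add (by positivity) (by positivity)]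
    refine add_le_add ih ?_
    refine (klDiv_compProd_right_le (c := fun x => E.indicator (fun _ => ENNReal.ofReal η) x.2)
      _ _ _ (fun x => ?_) fun x => h x.2).trans ?_
    · by_cases hx : x.2 ∈ E <;> simp [hx]
    · have hi : Measurable (E.indicator fun _ => ENNReal.ofReal η) :=
        measurable_const.indicator hE
      rw [← lintegral_map (μ := task.histLaw alg M t ⊗ₘ decisionKernel alg t) hi measurable_snd]
      change ∫⁻ d, _ ∂(Measure.snd _) ≤ _
      rw [snd_histLaw_compProd, lintegral_indicator hE, setLIntegral_const,
        ENNReal.ofReal_mul hη, Measure.real, ENNReal.ofReal_toReal (measure_ne_top _ _)]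

/-- In every round, coordinate `i` of the uniformly random hidden index `θ` is missed with
probability at least `1 / 8`. The model `m θ` is compared with the one where coordinate `i` is
`none`: they differ only in the responses to the decisions `d` with `act d i = θ i`, and under the
latter model these decisions are rare for most values of `θ i`. -/
lemma sum_decisionLaw_ne_ge [MeasurableSpace.CountablyGenerated Obs] [Finite Dec]
    [MeasurableSingletonClass Dec] {I A : Type*} [Fintype I] [DecidableEq I] [Fintype A]
    (m : (I → Option A) → Model) (act : Dec → I → A) {η : ℝ} (hη : 0 ≤ η)
    (hKL : ∀ (θ : I → Option A) (i : I) (a : A), θ i = none → ∀ d,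
      klDiv (task.feedback (m θ, d, ()))
        (task.feedback (m (Function.update θ i (some a)), d, ())) ≤
        {d | act d i = a}.indicator (fun _ => ENNReal.ofReal η) d)
    {T : ℕ} (hA : 2 ≤ Fintype.card A) (hT : η * T ≤ (Fintype.card A : ℝ) / 4)
    (t : Fin T) (i : I) :
    (Fintype.card (I → A) : ℝ) / 8 ≤ ∑ θ : I → A,
      (task.decisionLaw alg (m fun i => some (θ i)) t).real {d | act d i ≠ θ i} := by
  have hmeas : ∀ s : Set Dec, MeasurableSet s := fun s => s.toFinite.measurableSet
  set W : (I → A) → ℝ := fun θ =>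
    (task.decisionLaw alg (m fun i => some (θ i)) t).real {d | act d i ≠ θ i} with hW
  have hA' : (2 : ℝ) ≤ Fintype.card A := by exact_mod_cast hA
  have hpart : ∀ (N : Model) (s : ℕ),
      ∑ a, (task.decisionLaw alg N s).real {d | act d i = a} = 1 := fun N s => by
    have := sum_measureReal_preimage_singleton (μ := task.decisionLaw alg N s)
      (Finset.univ : Finset A) (f := fun d => act d i) (fun a _ => hmeas _)
    simpa [Set.preimage] using this
  -- resample the coordinate `i` of `θ`
  have key : ∀ θ : I → A,
      (Fintype.card A : ℝ) - 1 - η * T ≤ 2 * ∑ a, W (Function.update θ i a) := fun θ => by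
    set θ₀ : I → Option A := Function.update (fun i => some (θ i)) i none with hθ₀
    have hup : ∀ a, Function.update θ₀ i (some a) =
        fun j => some (Function.update θ i a j) := fun a => by
      funext j
      by_cases hj : j = i
      · subst hj; simp
      · simp [hθ₀, hj]
    have h1 : ∀ a, 1 - (task.decisionLaw alg (m θ₀) t).real {d | act d i = a} ≤
        η * ∑ s ∈ Finset.range t, (task.decisionLaw alg (m θ₀) s).real {d | act d i = a} +
          2 * W (Function.update θ i a) := fun a => by
      have h2 := task.klDiv_histLaw_le alg (m θ₀) (m (Function.update θ₀ i (some a)))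
        (hmeas {d | act d i = a}) hη (hKL θ₀ i a (by simp [hθ₀])) t
      have h3 := measureReal_le_klDiv_add (s := {d | act d i ≠ a}) _ _ (by positivity)
        ((klDiv_comp_right_le _ _ (decisionKernel alg t)).trans h2)
      rw [hup] at h3
      simp only [hW, Function.update_self]
      have h4 := probReal_compl_eq_one_sub (μ := task.decisionLaw alg (m θ₀) t)
        (hmeas {d | act d i = a})
      rw [← h4]
      exact h3
    have h5 := Finset.sum_le_sum fun a (_ : a ∈ Finset.univ) => h1 a
    rw [Finset.sum_sub_distrib, hpart, Finset.sum_add_distrib, ← Finset.mul_sum,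
      ← Finset.mul_sum, Finset.sum_comm] at h5
    simp only [hpart, Finset.sum_const, Finset.card_univ, nsmul_eq_mul, mul_one,
      Finset.card_range] at h5
    have h6 : η * (t : ℕ) ≤ η * T := by
      have : ((t : ℕ) : ℝ) ≤ T := by exact_mod_cast t.2.le
      gcongr
    linarith
  have h7 := Finset.sum_le_sum fun θ (_ : θ ∈ Finset.univ) => key θ
  rw [← Finset.mul_sum, sum_sum_update, Finset.sum_const, nsmul_eq_mul, Finset.card_univ] at h7
  have h8 : (Fintype.card (I → A) : ℝ) * (Fintype.card A / 4) ≤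
      (Fintype.card (I → A) : ℝ) * (Fintype.card A - 1 - η * T) := by
    gcongr
    linarith
  have h9 : (Fintype.card A : ℝ) * (Fintype.card (I → A) / 8) ≤ Fintype.card A * ∑ θ, W θ := by
    linarith
  exact le_of_mul_le_mul_left h9 (by linarith)

/-- Lower bound for a uniformly random hidden index `θ : I → A`: every wrong coordinate of a
decision costs `ρ`, while the response reveals at most `η` nats about each coordinate, and nothing about the
coordinates that are guessed wrong. -/
theorem le_bayesRegret_of_uniform [MeasurableSpace.CountablyGenerated Obs] [Finite Dec]
    [MeasurableSingletonClass Dec] {I A : Type*} [Fintype I] [DecidableEq I] [Fintype A]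
    [DecidableEq A]
    (m : (I → Option A) → Model) (act : Dec → I → A) {η ρ : ℝ} (hη : 0 ≤ η) (hρ : 0 ≤ ρ)
    (hprior : (task.prior : Measure (Model × Unit)).fst =
      uniformLaw fun θ : I → A => m fun i => some (θ i))
    (hKL : ∀ (θ : I → Option A) (i : I) (a : A), θ i = none → ∀ d,
      klDiv (task.feedback (m θ, d, ()))
        (task.feedback (m (Function.update θ i (some a)), d, ())) ≤
        {d | act d i = a}.indicator (fun _ => ENNReal.ofReal η) d)
    (hgap : ∀ (θ : I → A) (d : Dec), ρ * ∑ i, (if act d i ≠ θ i then 1 else 0) ≤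
      task.bestMean (m fun i => some (θ i)) () - task.mean (m fun i => some (θ i)) d ())
    {T : ℕ} (hA : 2 ≤ Fintype.card A) (hT : η * T ≤ (Fintype.card A : ℝ) / 4) :
    ρ * Fintype.card I * T / 8 ≤ task.bayesRegret alg T := by
  have : Nonempty A := Fintype.card_pos_iff.1 (by omega)
  have hN : (0 : ℝ) < Fintype.card (I → A) := by exact_mod_cast Fintype.card_pos
  rw [task.bayesRegret_eq_sum alg _ hprior, le_inv_mul_iff₀ hN]
  have h1 : ∀ (θ : I → A) (t : Fin T), ρ * ∑ i,
      (task.decisionLaw alg (m fun i => some (θ i)) t).real {d | act d i ≠ θ i} ≤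
      ∫ d, (task.bestMean (m fun i => some (θ i)) () - task.mean (m fun i => some (θ i)) d ())
        ∂(task.decisionLaw alg (m fun i => some (θ i)) t) := fun θ t => by
    refine le_trans (le_of_eq ?_)
      (integral_mono Integrable.of_finite Integrable.of_finite (hgap θ))
    rw [integral_const_mul, integral_finsetSum _ fun i _ => Integrable.of_finite]
    congr 1
    refine Finset.sum_congr rfl fun i _ => ?_
    rw [← integral_indicator_one (Set.toFinite _).measurableSet]
    refine integral_congr_ae (ae_of_all _ fun d => ?_)
    simp [Set.indicator_apply]
  calc (Fintype.card (I → A) : ℝ) * (ρ * Fintype.card I * T / 8)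
      = ∑ t : Fin T, ρ * ∑ i : I, (Fintype.card (I → A) : ℝ) / 8 := by
        simp; ring
    _ ≤ ∑ t : Fin T, ρ * ∑ i, ∑ θ : I → A,
        (task.decisionLaw alg (m fun i => some (θ i)) t).real {d | act d i ≠ θ i} := by
        gcongr with t _ i _
        exact task.sum_decisionLaw_ne_ge alg m act hη hKL hA hT t i
    _ = ∑ θ : I → A, ∑ t : Fin T, ρ * ∑ i,
        (task.decisionLaw alg (m fun i => some (θ i)) t).real {d | act d i ≠ θ i} := by
        rw [Finset.sum_comm]
        refine Finset.sum_congr rfl fun t _ => ?_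
        rw [Finset.sum_comm, Finset.mul_sum]
    _ ≤ _ := Finset.sum_le_sum fun θ _ => Finset.sum_le_sum fun t _ => h1 θ t

end Task

/-! ### Success probabilities of the hard instances -/

/-- The success probability `1 - δ / 2` of an ordinary action, or `1 - δ / 2 + δ ε` of the hidden
best action, projected to `[0, 1]` to be defined for all `δ` and `ε`. -/
def successProb (δ ε : ℝ) (b : Bool) : unitInterval :=
  Set.projIcc 0 1 zero_le_one (1 - δ / 2 + if b then δ * ε else 0)

lemma coe_successProb {δ ε : ℝ} (hδ : 0 < δ) (hδ' : δ ≤ 1) (hε : 0 ≤ ε) (hε' : ε ≤ 1 / 4)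
    (b : Bool) : (successProb δ ε b : ℝ) = 1 - δ / 2 + if b then δ * ε else 0 := by
  have : 0 ≤ δ * ε := by positivity
  rw [successProb, Set.projIcc_of_mem]
  constructor <;> split_ifs <;> nlinarith

/-- Lowering the failure probability `δ / 2` by `δ ε` gives a divergence `O(δ ε²)`, as
`(δ ε)² / δ = δ ε²`. -/
lemma klDiv_successProb_le {α : Type*} [MeasurableSpace α] (x y : α) {δ ε : ℝ} (hδ : 0 < δ)
    (hδ' : δ ≤ 1) (hε : 0 ≤ ε) (hε' : ε ≤ 1 / 4) :
    klDiv (bernoulliMeasure x y (successProb δ ε false))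
      (bernoulliMeasure x y (successProb δ ε true)) ≤ ENNReal.ofReal (6 * δ * ε ^ 2) := by
  have h0 := coe_successProb hδ hδ' hε hε' false
  have h1 := coe_successProb hδ hδ' hε hε' true
  simp only [Bool.false_eq_true, ↓reduceIte, add_zero] at h0 h1
  have hδε : 0 ≤ δ * ε := by positivity
  have hq : 1 / 2 ≤ (successProb δ ε true : ℝ) := by rw [h1]; linarith
  have hq' : δ / 4 ≤ 1 - (successProb δ ε true : ℝ) := by rw [h1]; nlinarith
  refine (klDiv_bernoulliMeasure_le x y _ _ (by linarith) (by linarith)).trans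
    (ENNReal.ofReal_le_ofReal ?_)
  have e1 : 1 / (successProb δ ε true : ℝ) ≤ 2 := by
    rw [div_le_iff₀ (by linarith)]; linarith
  have e2 : 1 / (1 - (successProb δ ε true : ℝ)) ≤ 4 / δ := by
    rw [div_le_div_iff₀ (by linarith) hδ]; linarith
  calc ((successProb δ ε false : ℝ) - successProb δ ε true) ^ 2 *
        (1 / (successProb δ ε true : ℝ) + 1 / (1 - (successProb δ ε true : ℝ)))
      ≤ ((successProb δ ε false : ℝ) - successProb δ ε true) ^ 2 * (2 + 4 / δ) := by gcongr
    _ = (δ * ε) ^ 2 * (2 + 4 / δ) := by rw [h0, h1]; ring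
    _ = 2 * δ * ε ^ 2 * δ + 4 * δ * ε ^ 2 := by field_simp
    _ ≤ 6 * δ * ε ^ 2 := by
      have : 0 ≤ 2 * δ * ε ^ 2 := by positivity
      nlinarith

/-- The gap `ε = √(N / T) / 5` is the largest, up to a constant, for which `T` rounds with
information `ε²` each do not reveal `N` values. -/
lemma exists_gap {N T : ℝ} (hN : 0 < N) (hNT : N ≤ T) :
    ∃ ε : ℝ, 0 ≤ ε ∧ ε ≤ 1 / 4 ∧ ε ^ 2 * T = N / 25 ∧ ε * T = √(N * T) / 5 := by
  have hT : 0 < T := hN.trans_le hNT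
  refine ⟨√(N / T) / 5, by positivity, ?_, ?_, ?_⟩
  · have : √(N / T) ≤ 1 := Real.sqrt_le_one.2 ((div_le_one hT).2 hNT)
    linarith
  · rw [div_pow, Real.sq_sqrt (by positivity)]
    field_simp
    norm_num
  · have : √(N * T) = √(N / T) * T := by
      rw [show N * T = N / T * T ^ 2 by field_simp, Real.sqrt_mul (by positivity),
        Real.sqrt_sq hT.le]
    rw [this]; ring

/-! ### Bandits with one hidden good arm -/

section Bandit

variable {Dec : Type*} [Fintype Dec] [DecidableEq Dec] [MeasurableSpace Dec]
  [MeasurableSingletonClass Dec]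

/-- The bandit in which the arm `θ ()`, if any, has mean `1 / 2 + ε` and the others `1 / 2`. -/
def hiddenArm (ε : ℝ) (θ : Unit → Option Dec) : (Dec × Unit) → unitInterval :=
  fun x => successProb 1 ε (decide (θ () = some x.1))

lemma banditTask_feedback (P : ProbabilityMeasure (((Dec × Unit) → unitInterval) × Unit))
    (x : ((Dec × Unit) → unitInterval) × Dec × Unit) :
    (banditTask P).feedback x =
      (bernoulliMeasure (1 : ℝ) 0 (x.1 x.2)).map (fun r : ℝ => (r, r)) := rfl

lemma banditTask_mean (P : ProbabilityMeasure (((Dec × Unit) → unitInterval) × Unit))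
    (f : (Dec × Unit) → unitInterval) (d : Dec) :
    (banditTask P).mean f d () = f (d, ()) := by
  rw [Task.mean, banditTask_feedback, integral_map (by fun_prop) (by fun_prop),
    integral_bernoulliMeasure]
  simp

theorem exists_prior_banditTask (T : ℕ) (hK : 2 ≤ Fintype.card Dec) (hT : Fintype.card Dec ≤ T) :
    ∃ P : ProbabilityMeasure (((Dec × Unit) → unitInterval) × Unit),
      ∀ alg : Algorithm Dec Unit ℝ,
        1 / 120 * √((Fintype.card Dec : ℝ) * T) ≤ (banditTask P).bayesRegret alg T := by
  have : Nonempty Dec := Fintype.card_pos_iff.1 (by omega)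
  obtain ⟨ε, hε, hε', h1, h2⟩ := exists_gap (N := Fintype.card Dec) (T := T)
    (by exact_mod_cast Fintype.card_pos) (by exact_mod_cast hT)
  let P : ProbabilityMeasure (((Dec × Unit) → unitInterval) × Unit) :=
    ⟨uniformLaw fun θ : Unit → Dec => (hiddenArm ε fun i => some (θ i), ()), inferInstance⟩
  refine ⟨P, fun alg => ?_⟩
  have key := (banditTask P).le_bayesRegret_of_uniform alg (T := T) (I := Unit) (A := Dec)
    (hiddenArm ε) (fun d _ => d) (η := 6 * ε ^ 2) (ρ := ε) (by positivity) hε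
    (map_uniformLaw _ measurable_fst) ?_ ?_ hK ?_
  · simp only [Fintype.card_unit, Nat.cast_one, mul_one] at key
    have := Real.sqrt_nonneg ((Fintype.card Dec : ℝ) * T)
    linarith
  · intro θ i a hθ d
    rw [banditTask_feedback, banditTask_feedback]
    refine (klDiv_map_le _ _ (by fun_prop)).trans ?_
    by_cases hd : d = a
    · subst hd
      simpa [hiddenArm, hθ] using klDiv_successProb_le (1 : ℝ) 0 one_pos le_rfl hε hε'
    · simp [hiddenArm, hθ, hd, Ne.symm hd]
  · intro θ d
    have hb : (banditTask P).mean (hiddenArm ε fun i => some (θ i)) (θ ()) () ≤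
        (banditTask P).bestMean (hiddenArm ε fun i => some (θ i)) () :=
      le_ciSup (f := fun d => (banditTask P).mean (hiddenArm ε fun i => some (θ i)) d ())
        (Set.finite_range _).bddAbove (θ ())
    refine le_trans ?_ (sub_le_sub_right hb _)
    rw [banditTask_mean, banditTask_mean]
    simp only [hiddenArm, coe_successProb one_pos le_rfl hε hε']
    by_cases hd : d = θ ()
    · simp [hd]
    · simp [hd, Ne.symm hd]
  · have : (0 : ℝ) ≤ Fintype.card Dec := Nat.cast_nonneg _
    linarith

end Bandit

/-! ### Episodes of a tabular MDP -/

namespace MDP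

section General

variable {S A : Type*} {H : ℕ} [MeasurableSpace S] [Finite S] [MeasurableSingletonClass S]
  [Finite A] [MeasurableSpace A] [MeasurableSingletonClass A]

instance (n : ℕ) (hn : n ≤ H) : IsMarkovKernel (prefixKernel (S := S) (A := A) n hn) :=
  isMarkovKernel_prefixKernel n hn

instance (h : Fin H) : IsMarkovKernel (rewKernel (S := S) (A := A) h) :=
  ⟨fun x => (x.1.rew _ _ _).2⟩

instance (h : Fin H) : IsMarkovKernel (transKernel (S := S) (A := A) h) :=
  ⟨fun x => (x.1.trans _ _ _).2⟩

instance (h : Fin H) (n : ℕ) : IsMarkovKernel (stageKernel (S := S) (A := A) h n) := by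
  unfold stageKernel
  infer_instance

lemma stageKernel_apply (M : MDP S A H) (π : Policy S A H) (h : Fin H) (n : ℕ)
    (y : (Fin n → Stage S A) × S) :
    stageKernel h n ((M, π), y) = (Measure.dirac (π (y.2, h))).prod
      ((M.rew h y.2 (π (y.2, h)) : Measure unitInterval).prod
        (M.trans h y.2 (π (y.2, h)) : Measure S)) := by
  rw [stageKernel, Kernel.prod_apply, Kernel.deterministic_apply, Kernel.comap_apply,
    Kernel.prod_apply]
  rfl

lemma measurable_snoc_stage (n : ℕ) : Measurable
    (fun x : ((Fin n → Stage S A) × S) × (A × unitInterval × S) =>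
      ((Fin.snoc x.1.1 (x.1.2, x.2.1, x.2.2.1) : Fin (n + 1) → Stage S A), x.2.2.2)) :=
  (measurable_snoc (by fun_prop) (by fun_prop)).prodMk (by fun_prop)

lemma prefixKernel_succ_apply (M : MDP S A H) (π : Policy S A H) (n : ℕ) (hn : n + 1 ≤ H) :
    prefixKernel (n + 1) hn (M, π) =
      ((prefixKernel n (Nat.le_of_succ_le hn) (M, π)) ⊗ₘ
        (stageKernel ⟨n, hn⟩ n).sectR (M, π)).map
      (fun x => (Fin.snoc x.1.1 (x.1.2, x.2.1, x.2.2.1), x.2.2.2)) := by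
  rw [prefixKernel, Kernel.map_apply _ (measurable_snoc_stage n),
    Kernel.compProd_apply_eq_compProd_sectR]

lemma lintegral_prefixKernel_succ (M : MDP S A H) (π : Policy S A H) (n : ℕ) (hn : n + 1 ≤ H)
    {f : (Fin (n + 1) → Stage S A) × S → ℝ≥0∞} (hf : Measurable f) :
    ∫⁻ x, f x ∂(prefixKernel (n + 1) hn (M, π)) =
      ∫⁻ y, ∫⁻ r, ∫⁻ s, f (Fin.snoc y.1 (y.2, π (y.2, ⟨n, hn⟩), r), s)
        ∂(M.trans ⟨n, hn⟩ y.2 (π (y.2, ⟨n, hn⟩)) : Measure S)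
        ∂(M.rew ⟨n, hn⟩ y.2 (π (y.2, ⟨n, hn⟩)) : Measure unitInterval)
        ∂(prefixKernel n (Nat.le_of_succ_le hn) (M, π)) := by
  have hg := hf.comp (measurable_snoc_stage (S := S) (A := A) n)
  simp only [Function.comp_def] at hg
  rw [prefixKernel_succ_apply, lintegral_map hf (measurable_snoc_stage n),
    Measure.lintegral_compProd hg]
  refine lintegral_congr fun y => ?_
  have hg' := hg.comp (measurable_prodMk_left (x := y))
  simp only [Function.comp_def] at hg'
  rw [Kernel.sectR_apply, stageKernel_apply, lintegral_prod _ hg'.aemeasurable,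
    lintegral_dirac, lintegral_prod]
  exact (hg'.comp measurable_prodMk_left).aemeasurable

/-- The law of the state after `n` stages. -/
def stateMarginal (M : MDP S A H) (π : Policy S A H) (n : ℕ) (hn : n ≤ H) : Measure S :=
  (prefixKernel n hn (M, π)).snd

instance (M : MDP S A H) (π : Policy S A H) (n : ℕ) (hn : n ≤ H) :
    IsProbabilityMeasure (stateMarginal M π n hn) := by
  unfold stateMarginal
  infer_instance

lemma lintegral_prefixKernel_state (M : MDP S A H) (π : Policy S A H) (n : ℕ) (hn : n ≤ H)
    (f : S → ℝ≥0∞) :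
    ∫⁻ x, f x.2 ∂(prefixKernel n hn (M, π)) = ∫⁻ s, f s ∂(stateMarginal M π n hn) :=
  (lintegral_map (measurable_of_countable f) measurable_snd).symm

lemma stateMarginal_succ (M : MDP S A H) (π : Policy S A H) (n : ℕ) (hn : n + 1 ≤ H) (s' : S) :
    stateMarginal M π (n + 1) hn {s'} =
      ∫⁻ s, (M.trans ⟨n, hn⟩ s (π (s, ⟨n, hn⟩)) : Measure S) {s'}
        ∂(stateMarginal M π n (Nat.le_of_succ_le hn)) := by
  rw [← lintegral_prefixKernel_state, ← lintegral_indicator_one (measurableSet_singleton s'),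
    ← lintegral_prefixKernel_state, lintegral_prefixKernel_succ]
  · refine lintegral_congr fun y => ?_
    simp only [lintegral_const, measure_univ, mul_one]
    exact lintegral_indicator_one (measurableSet_singleton s')
  · exact (measurable_of_countable (({s'} : Set S).indicator (1 : S → ℝ≥0∞))).comp
      measurable_snd

/-- The reward collected in the first `n` stages, in `ℝ≥0∞` so that no integrability is needed. -/
def collected {n : ℕ} (τ : Fin n → Stage S A) : ℝ≥0∞ :=
  ∑ i, ENNReal.ofReal (τ i).2.2

lemma measurable_collected {n : ℕ} :
    Measurable (collected : (Fin n → Stage S A) → ℝ≥0∞) := by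
  unfold collected
  fun_prop

lemma collected_snoc {n : ℕ} (τ : Fin n → Stage S A) (x : Stage S A) :
    collected (Fin.snoc τ x : Fin (n + 1) → Stage S A) =
      collected τ + ENNReal.ofReal x.2.2 := by
  simp [collected, Fin.sum_univ_castSucc]

lemma ofReal_totalReward (τ : Fin H → Stage S A) :
    ENNReal.ofReal (totalReward τ) = collected τ := by
  rw [totalReward, collected, ENNReal.ofReal_sum_of_nonneg fun i _ => (τ i).2.2.2.1]

lemma lintegral_collected_succ (M : MDP S A H) (π : Policy S A H) (n : ℕ) (hn : n + 1 ≤ H) :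
    ∫⁻ x, collected x.1 ∂(prefixKernel (n + 1) hn (M, π)) =
      ∫⁻ x, collected x.1 ∂(prefixKernel n (Nat.le_of_succ_le hn) (M, π)) +
        ∫⁻ s, ∫⁻ r, ENNReal.ofReal r
          ∂(M.rew ⟨n, hn⟩ s (π (s, ⟨n, hn⟩)) : Measure unitInterval)
          ∂(stateMarginal M π n (Nat.le_of_succ_le hn)) := by
  have hc : ∀ k, Measurable (fun x : (Fin k → Stage S A) × S => collected x.1) := fun k =>
    measurable_collected.comp measurable_fst
  rw [lintegral_prefixKernel_succ _ _ _ _ (hc _), ← lintegral_prefixKernel_state,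
    ← lintegral_add_left (hc _)]
  refine lintegral_congr fun y => ?_
  simp only [collected_snoc, lintegral_const, measure_univ, mul_one]
  rw [lintegral_add_left measurable_const]
  simp

end General

/-! ### The survival chain -/

section Survival

variable {m : ℕ} [NeZero m]

/-- The next state of the survival chain: `0` is absorbing, and the survivor is put into a
uniformly random state among the others. -/
def survivalKernel (m : ℕ) : Kernel Bool (Fin (m + 1)) :=
  Kernel.ofFunOfCountable fun b => bif b then uniformLaw Fin.succ else Measure.dirac 0

instance : IsMarkovKernel (survivalKernel m) :=
  ⟨fun b => by
    cases b <;>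
      simp only [survivalKernel, Kernel.ofFunOfCountable, Kernel.coe_mk, cond_true, cond_false] <;>
      infer_instance⟩

/-- The law of the next state when the survival probability is `p`. -/
def survivalLaw (m : ℕ) (p : unitInterval) : Measure (Fin (m + 1)) :=
  survivalKernel m ∘ₘ bernoulliMeasure true false p

instance (p : unitInterval) : IsProbabilityMeasure (survivalLaw m p) := by
  unfold survivalLaw
  infer_instance

lemma survivalLaw_succ (p : unitInterval) (j : Fin m) :
    survivalLaw m p {j.succ} = ENNReal.ofReal (p / m) := by
  have hm : (0 : ℝ) < m := Nat.cast_pos.2 (Nat.pos_of_neZero m)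
  have h1 : survivalKernel m true {j.succ} = ENNReal.ofReal (1 / m) := by
    change uniformLaw Fin.succ {j.succ} = _
    rw [uniformLaw, Measure.smul_apply, Measure.finsetSum_apply, one_div,
      ENNReal.ofReal_inv_of_pos hm]
    simp [Set.indicator_apply]
  have h2 : survivalKernel m false {j.succ} = 0 := by
    change Measure.dirac 0 {j.succ} = _
    simp [(Fin.succ_ne_zero j).symm]
  rw [survivalLaw, Measure.bind_apply (measurableSet_singleton _) (by fun_prop),
    bernoulliMeasure_def, lintegral_add_measure]
  have e : (p : ℝ) / m = p * (1 / m) := by ring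
  rw [e, ENNReal.ofReal_mul p.2.1, ← h1]
  simp only [lintegral_smul_measure, lintegral_dirac, h2, smul_zero, add_zero]
  rw [ENNReal.smul_def, smul_eq_mul]
  congr 1
  rw [← ENNReal.ofReal_coe_nnreal]
  rfl

end Survival

section Hard

variable {m K n : ℕ} [NeZero m]

/-- The survival probability of action `a` in state `s` at stage `h`: it is increased for the
hidden action `θ (h, j)`, if any, of the state `j.succ`. The failure probability of a stage is of
order `1 / H`, so that an episode is survived with a probability bounded from below. -/
def surviveProb (ε : ℝ) (θ : Fin (n + 1) × Fin m → Option (Fin K)) (h : Fin (n + 1))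
    (s : Fin (m + 1)) (a : Fin K) : unitInterval :=
  Fin.cases 0 (fun j => successProb (1 / ((n : ℝ) + 1)) ε (decide (θ (h, j) = some a))) s

/-- The survival MDP: a survivor moves to a uniformly random state other than the absorbing state
`0`, with the survival probabilities `surviveProb`. The only reward, `1`, is for surviving the last
stage, whose transition is then irrelevant and leads to `0`. -/
def hardMDP (ε : ℝ) (θ : Fin (n + 1) × Fin m → Option (Fin K)) :
    MDP (Fin (m + 1)) (Fin K) (n + 1) where
  init := ⟨survivalLaw m 1, inferInstance⟩
  trans h s a := ⟨survivalLaw m (if h = Fin.last n then 0 else surviveProb ε θ h s a),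
    inferInstance⟩
  rew h s a := ⟨bernoulliMeasure 1 0 (if h = Fin.last n then surviveProb ε θ h s a else 0),
    inferInstance⟩

lemma coe_trans_hardMDP (ε : ℝ) (θ : Fin (n + 1) × Fin m → Option (Fin K)) (h : Fin (n + 1))
    (s : Fin (m + 1)) (a : Fin K) : ((hardMDP ε θ).trans h s a : Measure (Fin (m + 1))) =
      survivalLaw m (if h = Fin.last n then 0 else surviveProb ε θ h s a) := rfl

lemma coe_rew_hardMDP (ε : ℝ) (θ : Fin (n + 1) × Fin m → Option (Fin K)) (h : Fin (n + 1))
    (s : Fin (m + 1)) (a : Fin K) : ((hardMDP ε θ).rew h s a : Measure unitInterval) =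
      bernoulliMeasure 1 0 (if h = Fin.last n then surviveProb ε θ h s a else 0) := rfl

lemma surviveProb_zero (ε : ℝ) (θ : Fin (n + 1) × Fin m → Option (Fin K)) (h : Fin (n + 1))
    (a : Fin K) : surviveProb ε θ h 0 a = 0 := rfl

lemma surviveProb_succ (ε : ℝ) (θ : Fin (n + 1) × Fin m → Option (Fin K)) (h : Fin (n + 1))
    (j : Fin m) (a : Fin K) : surviveProb ε θ h j.succ a =
      successProb (1 / ((n : ℝ) + 1)) ε (decide (θ (h, j) = some a)) := rfl

/-- The survival probability of stage `h` when the state is uniformly random. -/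
def meanSurvival (ε : ℝ) (θ : Fin (n + 1) × Fin m → Option (Fin K))
    (π : Policy (Fin (m + 1)) (Fin K) (n + 1)) (h : Fin (n + 1)) : ℝ :=
  (∑ j : Fin m, (surviveProb ε θ h j.succ (π (j.succ, h)) : ℝ)) / m

variable (ε : ℝ) (θ : Fin (n + 1) × Fin m → Option (Fin K))
  (π : Policy (Fin (m + 1)) (Fin K) (n + 1))

lemma meanSurvival_nonneg (h : Fin (n + 1)) : 0 ≤ meanSurvival ε θ π h :=
  div_nonneg (Finset.sum_nonneg fun j _ => (surviveProb ε θ h j.succ _).2.1) (Nat.cast_nonneg m)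

lemma meanSurvival_le_one (h : Fin (n + 1)) : meanSurvival ε θ π h ≤ 1 := by
  refine div_le_one_of_le₀ ?_ (Nat.cast_nonneg m)
  refine (Finset.sum_le_sum fun j _ => (surviveProb ε θ h j.succ _).2.2).trans ?_
  simp

/-- The probability of survival of the first `k` stages. -/
def survival (k : ℕ) (hk : k ≤ n + 1) : ℝ :=
  ∏ i : Fin k, meanSurvival ε θ π (Fin.castLE hk i)

lemma survival_nonneg (k : ℕ) (hk : k ≤ n + 1) : 0 ≤ survival ε θ π k hk :=
  Finset.prod_nonneg fun _ _ => meanSurvival_nonneg ε θ π _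

lemma survival_le_one (k : ℕ) (hk : k ≤ n + 1) : survival ε θ π k hk ≤ 1 :=
  Finset.prod_le_one (fun _ _ => meanSurvival_nonneg ε θ π _)
    fun _ _ => meanSurvival_le_one ε θ π _

lemma survival_succ (k : ℕ) (hk : k + 1 ≤ n + 1) :
    survival ε θ π (k + 1) hk =
      survival ε θ π k (Nat.le_of_succ_le hk) * meanSurvival ε θ π ⟨k, hk⟩ := by
  rw [survival, Fin.prod_univ_castSucc]
  rfl

lemma survival_eq_prod : survival ε θ π (n + 1) le_rfl = ∏ h, meanSurvival ε θ π h := rfl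

/-- A function of the state that vanishes at `0` is averaged over the uniform law of survivors. -/
lemma lintegral_of_stateMarginal {σ : Measure (Fin (m + 1))} {v : ℝ} (hv : 0 ≤ v)
    (hσ : ∀ j : Fin m, σ {j.succ} = ENNReal.ofReal (v / m)) (g : Fin (m + 1) → ℝ)
    (hg0 : g 0 = 0) (hg : ∀ s, 0 ≤ g s) :
    ∫⁻ s, ENNReal.ofReal (g s) ∂σ = ENNReal.ofReal (v * ((∑ j : Fin m, g j.succ) / m)) := by
  rw [lintegral_fintype, Fin.sum_univ_succ, hg0, ENNReal.ofReal_zero, zero_mul, zero_add]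
  simp_rw [hσ, ← ENNReal.ofReal_mul (hg _)]
  rw [← ENNReal.ofReal_sum_of_nonneg]
  · congr 1
    rw [← Finset.sum_mul]
    ring
  · intro j _
    exact mul_nonneg (hg _) (by positivity)

/-- The survivors are uniformly distributed. -/
lemma stateMarginal_hardMDP (k : ℕ) (hk : k ≤ n) (j : Fin m) :
    stateMarginal (hardMDP ε θ) π k (hk.trans n.le_succ) {j.succ} =
      ENNReal.ofReal (survival ε θ π k (hk.trans n.le_succ) / m) := by
  induction k generalizing j with
  | zero =>
    rw [stateMarginal, prefixKernel, Kernel.map_apply _ (by fun_prop), Measure.snd,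
      Measure.map_map (by fun_prop) (by fun_prop)]
    change (Measure.map id (survivalLaw m 1)) _ = _
    rw [Measure.map_id, survivalLaw_succ]
    simp [survival]
  | succ k ih =>
    have hne : (⟨k, hk.trans n.le_succ⟩ : Fin (n + 1)) ≠ Fin.last n := fun h => by
      have := congrArg Fin.val h
      simp at this
      omega
    rw [stateMarginal_succ]
    set h : Fin (n + 1) := ⟨k, hk.trans n.le_succ⟩
    have e : ∀ s, ((hardMDP ε θ).trans h s (π (s, h)) : Measure (Fin (m + 1))) {j.succ} =
        ENNReal.ofReal ((surviveProb ε θ h s (π (s, h)) : ℝ) / m) := fun s => by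
      rw [coe_trans_hardMDP, if_neg hne, survivalLaw_succ]
    rw [lintegral_congr e]
    have h2 := lintegral_of_stateMarginal (survival_nonneg ε θ π k _)
      (ih (Nat.le_of_succ_le hk)) (fun s => (surviveProb ε θ h s (π (s, h)) : ℝ) / m)
      (by simp [surviveProb_zero])
      fun s => div_nonneg (surviveProb ε θ h s _).2.1 (Nat.cast_nonneg m)
    refine h2.trans ?_
    rw [survival_succ, meanSurvival, ← Finset.sum_div]
    congr 1
    ring

lemma lintegral_rew_hardMDP (h : Fin (n + 1)) (s : Fin (m + 1)) (a : Fin K) :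
    ∫⁻ r, ENNReal.ofReal r ∂((hardMDP ε θ).rew h s a : Measure unitInterval) =
      ENNReal.ofReal (if h = Fin.last n then surviveProb ε θ h s a else 0 : unitInterval) := by
  rw [coe_rew_hardMDP, ← ofReal_integral_eq_lintegral_ofReal (integrable_bernoulliMeasure _ _ _ _)
    (ae_of_all _ fun r => r.2.1), integral_bernoulliMeasure]
  simp

lemma lintegral_collected_eq_zero (k : ℕ) (hk : k ≤ n) :
    ∫⁻ x, collected x.1 ∂(prefixKernel k (hk.trans n.le_succ) (hardMDP ε θ, π)) = 0 := by
  induction k with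
  | zero => simp [collected]
  | succ k ih =>
    have hne : (⟨k, hk.trans n.le_succ⟩ : Fin (n + 1)) ≠ Fin.last n := fun h => by
      have := congrArg Fin.val h
      simp at this
      omega
    rw [lintegral_collected_succ, ih (Nat.le_of_succ_le hk)]
    simp [lintegral_rew_hardMDP, hne]

/-- The value of a policy is its probability of survival. -/
lemma lintegral_collected_hardMDP :
    ∫⁻ τ, collected τ ∂(episodeKernel (hardMDP ε θ, π)) =
      ENNReal.ofReal (∏ h, meanSurvival ε θ π h) := by
  rw [episodeKernel, Kernel.map_apply _ measurable_fst,
    lintegral_map measurable_collected measurable_fst, lintegral_collected_succ,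
    lintegral_collected_eq_zero _ _ _ _ le_rfl, zero_add]
  simp_rw [lintegral_rew_hardMDP]
  have hl : (⟨n, n.lt_succ_self⟩ : Fin (n + 1)) = Fin.last n := rfl
  simp only [hl, ↓reduceIte]
  rw [lintegral_of_stateMarginal (survival_nonneg ε θ π n n.le_succ)
    (stateMarginal_hardMDP ε θ π n le_rfl)
    (fun s => (surviveProb ε θ (Fin.last n) s (π (s, Fin.last n)) : ℝ)) rfl
    fun s => (surviveProb ε θ _ s _).2.1, ← survival_eq_prod, survival_succ]
  rfl

lemma ae_totalReward_hardMDP_le :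
    ∀ᵐ τ ∂(episodeKernel (hardMDP ε θ, π)), totalReward τ ≤ 1 := by
  have hm : MeasurableSet {τ : Fin (n + 1) → Stage (Fin (m + 1)) (Fin K) | collected τ ≤ 1} :=
    measurableSet_le measurable_collected measurable_const
  have h0 : ∀ᵐ τ ∂(episodeKernel (hardMDP ε θ, π)), collected τ ≤ 1 := by
    rw [episodeKernel, Kernel.map_apply _ measurable_fst, ae_map_iff measurable_fst.aemeasurable hm]
    change (prefixKernel (n + 1) le_rfl (hardMDP ε θ, π)) (Prod.fst ⁻¹' {τ | collected τ ≤ 1})ᶜ = 0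
    rw [← lintegral_indicator_one (hm.preimage measurable_fst).compl, lintegral_prefixKernel_succ]
    · have h1 := lintegral_collected_eq_zero ε θ π n le_rfl
      rw [lintegral_eq_zero_iff (by exact measurable_collected.comp measurable_fst)] at h1
      rw [← lintegral_zero (α := (Fin n → Stage (Fin (m + 1)) (Fin K)) × Fin (m + 1))]
      refine lintegral_congr_ae (h1.mono fun y hy => ?_)
      rw [← lintegral_zero (α := unitInterval)]
      refine lintegral_congr fun r => ?_
      rw [← lintegral_zero (α := Fin (m + 1))]
      refine lintegral_congr fun s => ?_
      refine Set.indicator_of_notMem (Set.notMem_compl_iff.2 ?_) _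
      change collected (Fin.snoc y.1 _ : Fin (n + 1) → _) ≤ 1
      have hy' : collected y.1 = 0 := hy
      rw [collected_snoc, hy', zero_add]
      exact ENNReal.ofReal_le_one.2 r.2.2
    · exact measurable_one.indicator (hm.preimage measurable_fst).compl
  filter_upwards [h0] with τ hτ
  rw [← ofReal_totalReward] at hτ
  exact ENNReal.ofReal_le_one.1 hτ

end Hard

/-! ### Information in one episode -/

section Divergence

variable {m K n : ℕ} [NeZero m] {ε : ℝ}

/-- The bound on the divergence of stage `h`, for action `a` in state `s`, caused by hiding the
action `a₀` at the state `j₀.succ` of stage `h₀`. -/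
def stageInfo (n : ℕ) (ε : ℝ) (h₀ : Fin (n + 1)) (j₀ : Fin m) (a₀ : Fin K) (h : Fin (n + 1))
    (s : Fin (m + 1)) (a : Fin K) : ℝ :=
  if h = h₀ ∧ s = j₀.succ ∧ a = a₀ then 6 * (1 / ((n : ℝ) + 1)) * ε ^ 2 else 0

lemma klDiv_surviveProb_le {α : Type*} [MeasurableSpace α] (x y : α) (hε : 0 ≤ ε)
    (hε' : ε ≤ 1 / 4) (θ : Fin (n + 1) × Fin m → Option (Fin K)) (h₀ : Fin (n + 1)) (j₀ : Fin m)
    (a₀ : Fin K) (hθ : θ (h₀, j₀) = none) (h : Fin (n + 1)) (s : Fin (m + 1)) (a : Fin K) :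
    klDiv (bernoulliMeasure x y (surviveProb ε θ h s a))
      (bernoulliMeasure x y (surviveProb ε (Function.update θ (h₀, j₀) (some a₀)) h s a)) ≤
      ENNReal.ofReal (stageInfo n ε h₀ j₀ a₀ h s a) := by
  have hδ : (0 : ℝ) < 1 / ((n : ℝ) + 1) := by positivity
  have hδ' : 1 / ((n : ℝ) + 1) ≤ 1 := by
    rw [div_le_one (by positivity)]; linarith [Nat.cast_nonneg (α := ℝ) n]
  induction s using Fin.cases with
  | zero => simp [surviveProb_zero]
  | succ j =>
    rw [surviveProb_succ, surviveProb_succ]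
    by_cases hi : (h, j) = (h₀, j₀)
    · obtain ⟨rfl, rfl⟩ := Prod.ext_iff.1 hi
      simp only [hθ, Function.update_self]
      by_cases ha : a = a₀
      · subst ha
        simpa [stageInfo] using klDiv_successProb_le x y hδ hδ' hε hε'
      · simp [Ne.symm ha]
    · rw [Function.update_of_ne hi]
      simp

lemma klDiv_stageKernel_le (hε : 0 ≤ ε)
    (hε' : ε ≤ 1 / 4) (θ : Fin (n + 1) × Fin m → Option (Fin K)) (h₀ : Fin (n + 1)) (j₀ : Fin m)
    (a₀ : Fin K) (hθ : θ (h₀, j₀) = none) (π : Policy (Fin (m + 1)) (Fin K) (n + 1))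
    (h : Fin (n + 1)) (k : ℕ) (y : (Fin k → Stage (Fin (m + 1)) (Fin K)) × Fin (m + 1)) :
    klDiv (stageKernel h k ((hardMDP ε θ, π), y))
      (stageKernel h k ((hardMDP ε (Function.update θ (h₀, j₀) (some a₀)), π), y)) ≤
      ENNReal.ofReal (stageInfo n ε h₀ j₀ a₀ h y.2 (π (y.2, h))) := by
  rw [stageKernel_apply, stageKernel_apply]
  refine klDiv_prod_le.trans ?_
  rw [klDiv_self, zero_add]
  refine klDiv_prod_le.trans ?_
  rw [coe_rew_hardMDP, coe_rew_hardMDP, coe_trans_hardMDP, coe_trans_hardMDP]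
  split_ifs with hl
  · rw [klDiv_self, add_zero]
    exact klDiv_surviveProb_le _ _ hε hε' θ h₀ j₀ a₀ hθ h _ _
  · rw [klDiv_self, zero_add]
    exact (klDiv_comp_right_le _ _ _).trans
      (klDiv_surviveProb_le _ _ hε hε' θ h₀ j₀ a₀ hθ h _ _)

/-- An episode reveals little about the hidden action of a state: the state is reached at the given
stage with probability at most `1 / m`, and the divergence of one stage is `O(ε² / H)`. -/
lemma klDiv_prefixKernel_le (hε : 0 ≤ ε)
    (hε' : ε ≤ 1 / 4) (θ : Fin (n + 1) × Fin m → Option (Fin K)) (h₀ : Fin (n + 1)) (j₀ : Fin m)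
    (a₀ : Fin K) (hθ : θ (h₀, j₀) = none) (π : Policy (Fin (m + 1)) (Fin K) (n + 1))
    (k : ℕ) (hk : k ≤ n + 1) :
    klDiv (prefixKernel k hk (hardMDP ε θ, π))
      (prefixKernel k hk (hardMDP ε (Function.update θ (h₀, j₀) (some a₀)), π)) ≤
      ENNReal.ofReal (if h₀.1 < k ∧ π (j₀.succ, h₀) = a₀ then
        6 * (1 / ((n : ℝ) + 1)) * ε ^ 2 / m else 0) := by
  induction k with
  | zero =>
    have h0 : prefixKernel 0 hk (hardMDP ε (Function.update θ (h₀, j₀) (some a₀)), π) =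
        prefixKernel 0 hk (hardMDP ε θ, π) := by
      rw [prefixKernel, Kernel.map_apply _ (by fun_prop), Kernel.map_apply _ (by fun_prop)]
      rfl
    rw [h0, klDiv_self]
    exact zero_le
  | succ k ih =>
    rw [prefixKernel_succ_apply, prefixKernel_succ_apply]
    refine (klDiv_map_le _ _ (measurable_snoc_stage k)).trans ?_
    rw [klDiv_compProd_eq_add]
    have h1 := klDiv_compProd_right_le (prefixKernel k (Nat.le_of_succ_le hk) (hardMDP ε θ, π))
      ((stageKernel ⟨k, hk⟩ k).sectR (hardMDP ε θ, π))
      ((stageKernel ⟨k, hk⟩ k).sectR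
        (hardMDP ε (Function.update θ (h₀, j₀) (some a₀)), π))
      (c := fun y => ENNReal.ofReal (stageInfo n ε h₀ j₀ a₀ ⟨k, hk⟩ y.2 (π (y.2, ⟨k, hk⟩))))
      (fun y => ENNReal.ofReal_ne_top)
      (fun y => klDiv_stageKernel_le hε hε' θ h₀ j₀ a₀ hθ π ⟨k, hk⟩ k y)
    refine (add_le_add (ih (Nat.le_of_succ_le hk)) h1).trans ?_
    by_cases hh : (⟨k, hk⟩ : Fin (n + 1)) = h₀
    · subst hh
      simp only [lt_self_iff_false, false_and, ↓reduceIte, ENNReal.ofReal_zero, zero_add,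
        Nat.lt_succ_self, true_and]
      set h₀ : Fin (n + 1) := ⟨k, hk⟩
      rw [lintegral_prefixKernel_state _ _ _ _
        (fun s => ENNReal.ofReal (stageInfo n ε h₀ j₀ a₀ h₀ s (π (s, h₀))))]
      have h2 := lintegral_of_stateMarginal (survival_nonneg ε θ π k _)
        (stateMarginal_hardMDP ε θ π k (Nat.lt_succ_iff.1 hk))
        (fun s => stageInfo n ε h₀ j₀ a₀ h₀ s (π (s, h₀)))
        (by simp [stageInfo, (Fin.succ_ne_zero j₀).symm])
        (fun s => by unfold stageInfo; split_ifs <;> positivity)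
      refine h2.le.trans (ENNReal.ofReal_le_ofReal ?_)
      have h3 : ∑ j : Fin m, stageInfo n ε h₀ j₀ a₀ h₀ j.succ (π (j.succ, h₀)) =
          if π (j₀.succ, h₀) = a₀ then 6 * (1 / ((n : ℝ) + 1)) * ε ^ 2 else 0 := by
        rw [Finset.sum_eq_single j₀]
        · simp [stageInfo]
        · intro j _ hj
          simp [stageInfo, hj]
        · simp
      rw [h3, ite_div, zero_div]
      refine mul_le_of_le_one_left ?_ (survival_le_one ε θ π k _)
      split_ifs <;> positivity
    · have h4 : ∀ s a, stageInfo n ε h₀ j₀ a₀ ⟨k, hk⟩ s a = 0 := fun s a =>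
        if_neg fun h => hh h.1
      simp only [h4, ENNReal.ofReal_zero, lintegral_zero, add_zero]
      have h5 : h₀.1 < k + 1 ↔ h₀.1 < k := by
        have : h₀.1 ≠ k := fun h => hh (Fin.ext h.symm)
        omega
      simp only [h5, le_refl]

lemma klDiv_episodeKernel_le (hε : 0 ≤ ε) (hε' : ε ≤ 1 / 4)
    (θ : Fin (n + 1) × Fin m → Option (Fin K)) (i : Fin (n + 1) × Fin m) (a : Fin K)
    (hθ : θ i = none) (π : Policy (Fin (m + 1)) (Fin K) (n + 1)) :
    klDiv (episodeKernel (hardMDP ε θ, π))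
      (episodeKernel (hardMDP ε (Function.update θ i (some a)), π)) ≤
      ENNReal.ofReal (if π (i.2.succ, i.1) = a then
        6 * (1 / ((n : ℝ) + 1)) * ε ^ 2 / m else 0) := by
  rw [episodeKernel, Kernel.map_apply _ measurable_fst, Kernel.map_apply _ measurable_fst]
  refine (klDiv_map_le _ _ measurable_fst).trans ?_
  simpa only [i.1.2, true_and] using klDiv_prefixKernel_le hε hε' θ i.1 i.2 a hθ π _ le_rfl

end Divergence

end MDP

/-! ### Regret in the survival MDP -/

/-- If all factors lie in `[c, a]` with `c ≤ 1`, lowering them from `a` lowers their product by at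
least a multiple of the total amount. -/
lemma pow_sub_prod_ge {ι : Type*} (s : Finset ι) {a c : ℝ} (hc : 0 ≤ c) (hc' : c ≤ 1)
    (hac : c ≤ a) (b : ι → ℝ) (hb : ∀ i, c ≤ b i) (hb' : ∀ i, b i ≤ a) :
    c ^ s.card * ∑ i ∈ s, (a - b i) ≤ a ^ s.card - ∏ i ∈ s, b i := by
  classical
  induction s using Finset.induction_on with
  | empty => simp
  | insert i s hi ih =>
    rw [Finset.card_insert_of_notMem hi, Finset.sum_insert hi, Finset.prod_insert hi]
    have h0 : 0 ≤ ∑ i ∈ s, (a - b i) := Finset.sum_nonneg fun j _ => sub_nonneg.2 (hb' j)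
    have hcs : 0 ≤ c ^ s.card := by positivity
    have h1 : c ^ (s.card + 1) * (a - b i) ≤ a ^ s.card * (a - b i) := by
      refine mul_le_mul_of_nonneg_right ?_ (sub_nonneg.2 (hb' i))
      calc c ^ (s.card + 1) ≤ c ^ s.card := pow_le_pow_of_le_one hc hc' (Nat.le_succ _)
        _ ≤ a ^ s.card := pow_le_pow_left₀ hc hac _
    have h2 : c ^ (s.card + 1) * ∑ i ∈ s, (a - b i) ≤
        b i * (a ^ s.card - ∏ i ∈ s, b i) := by
      calc c ^ (s.card + 1) * ∑ i ∈ s, (a - b i) = c * (c ^ s.card * ∑ i ∈ s, (a - b i)) := by ring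
        _ ≤ b i * (c ^ s.card * ∑ i ∈ s, (a - b i)) :=
            mul_le_mul_of_nonneg_right (hb i) (by positivity)
        _ ≤ _ := mul_le_mul_of_nonneg_left ih (hc.trans (hb i))
    calc c ^ (s.card + 1) * (a - b i + ∑ i ∈ s, (a - b i))
        = c ^ (s.card + 1) * (a - b i) + c ^ (s.card + 1) * ∑ i ∈ s, (a - b i) := by ring
      _ ≤ a ^ s.card * (a - b i) + b i * (a ^ s.card - ∏ i ∈ s, b i) := add_le_add h1 h2
      _ = _ := by ring

section Tabular

variable {m K n : ℕ} [NeZero m] {ε : ℝ}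

/-- The survival MDP as a model with episode rewards in `[0, 1]`. -/
def boundedHardMDP (ε : ℝ) (θ : Fin (n + 1) × Fin m → Option (Fin K)) :
    BoundedMDP (Fin (m + 1)) (Fin K) (n + 1) :=
  ⟨MDP.hardMDP ε θ, MDP.ae_totalReward_hardMDP_le ε θ⟩

lemma tabularTask_feedback
    (P : ProbabilityMeasure (BoundedMDP (Fin (m + 1)) (Fin K) (n + 1) × Unit))
    (M : BoundedMDP (Fin (m + 1)) (Fin K) (n + 1)) (π : Policy (Fin (m + 1)) (Fin K) (n + 1)) :
    (tabularTask P).feedback (M, π, ()) =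
      (MDP.episodeKernel (M.1, π)).map (fun τ => (τ, totalReward τ)) := by
  have hm : Measurable fun τ : Fin (n + 1) → Stage (Fin (m + 1)) (Fin K) => (τ, totalReward τ) :=
    measurable_id.prodMk measurable_totalReward
  change (Kernel.map _ _) _ = _
  rw [Kernel.map_apply _ hm]
  rfl

lemma tabularTask_mean
    (P : ProbabilityMeasure (BoundedMDP (Fin (m + 1)) (Fin K) (n + 1) × Unit))
    (θ : Fin (n + 1) × Fin m → Option (Fin K)) (π : Policy (Fin (m + 1)) (Fin K) (n + 1)) :
    (tabularTask P).mean (boundedHardMDP ε θ) π () = ∏ h, MDP.meanSurvival ε θ π h := by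
  have hm : Measurable fun τ : Fin (n + 1) → Stage (Fin (m + 1)) (Fin K) => (τ, totalReward τ) :=
    measurable_id.prodMk measurable_totalReward
  rw [Task.mean, tabularTask_feedback, integral_map hm.aemeasurable
    measurable_snd.aestronglyMeasurable]
  change ∫ τ, totalReward τ ∂_ = _
  have h0 : ∀ τ : Fin (n + 1) → Stage (Fin (m + 1)) (Fin K), 0 ≤ totalReward τ :=
    fun τ => Finset.sum_nonneg fun h _ => (τ h).2.2.2.1
  rw [integral_eq_lintegral_of_nonneg_ae (ae_of_all _ h0)
    measurable_totalReward.aestronglyMeasurable]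
  simp_rw [MDP.ofReal_totalReward]
  rw [boundedHardMDP, MDP.lintegral_collected_hardMDP, ENNReal.toReal_ofReal]
  exact Finset.prod_nonneg fun h _ => MDP.meanSurvival_nonneg ε θ π h

lemma coe_surviveProb_hard (hε : 0 ≤ ε) (hε' : ε ≤ 1 / 4)
    (θ : Fin (n + 1) × Fin m → Option (Fin K)) (h : Fin (n + 1)) (j : Fin m) (a : Fin K) :
    (MDP.surviveProb ε θ h j.succ a : ℝ) = 1 - 1 / ((n : ℝ) + 1) / 2 +
      if θ (h, j) = some a then 1 / ((n : ℝ) + 1) * ε else 0 := by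
  have hδ' : 1 / ((n : ℝ) + 1) ≤ 1 := by
    rw [div_le_one (by positivity)]; linarith [Nat.cast_nonneg (α := ℝ) n]
  rw [MDP.surviveProb_succ, coe_successProb (by positivity) hδ' hε hε']
  simp

/-- A wrong action in one of the `H m` live pairs of stage and state costs `ε / (2 H m)`. -/
lemma gap_hardMDP (hε : 0 ≤ ε) (hε' : ε ≤ 1 / 4)
    (P : ProbabilityMeasure (BoundedMDP (Fin (m + 1)) (Fin K) (n + 1) × Unit))
    (θ : Fin (n + 1) × Fin m → Fin K) (π : Policy (Fin (m + 1)) (Fin K) (n + 1)) :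
    1 / ((n : ℝ) + 1) * ε / (2 * m) *
        ∑ i : Fin (n + 1) × Fin m, (if π (i.2.succ, i.1) ≠ θ i then (1 : ℝ) else 0) ≤
      (tabularTask P).bestMean (boundedHardMDP ε fun i => some (θ i)) () -
        (tabularTask P).mean (boundedHardMDP ε fun i => some (θ i)) π () := by
  have hm : (0 : ℝ) < m := Nat.cast_pos.2 (Nat.pos_of_neZero m)
  set δ : ℝ := 1 / ((n : ℝ) + 1) with hδ
  have hδ0 : 0 < δ := by positivity
  have hδ1 : δ ≤ 1 := by
    rw [hδ, div_le_one (by positivity)]; linarith [Nat.cast_nonneg (α := ℝ) n]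
  have hδε : 0 ≤ δ * ε := by positivity
  set b : Fin (n + 1) → ℝ := fun h => MDP.meanSurvival ε (fun i => some (θ i)) π h with hb
  have hs : ∀ h (j : Fin m) a, (MDP.surviveProb ε (fun i => some (θ i)) h j.succ a : ℝ) =
      1 - δ / 2 + δ * ε - δ * ε * (if a ≠ θ (h, j) then 1 else 0) := fun h j a => by
    rw [coe_surviveProb_hard hε hε']
    by_cases ha : a = θ (h, j)
    · simp [ha, hδ]
    · simp [ha, Ne.symm ha, hδ]
  have hbs : ∀ h, b h = 1 - δ / 2 + δ * ε -
      δ * ε / m * ∑ j : Fin m, (if π (j.succ, h) ≠ θ (h, j) then (1 : ℝ) else 0) := fun h => by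
    simp only [hb, MDP.meanSurvival, hs, Finset.sum_sub_distrib, ← Finset.mul_sum]
    simp only [Finset.sum_const, Finset.card_univ, Fintype.card_fin, nsmul_eq_mul]
    field_simp
  have hcount : ∀ h, ∑ j : Fin m, (if π (j.succ, h) ≠ θ (h, j) then (1 : ℝ) else 0) ≤ m :=
    fun h => by
      refine (Finset.sum_le_sum (g := fun _ => (1 : ℝ)) fun j _ => ?_).trans (by simp)
      split_ifs <;> norm_num
  have hcount0 : ∀ h, 0 ≤ ∑ j : Fin m, (if π (j.succ, h) ≠ θ (h, j) then (1 : ℝ) else 0) :=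
    fun h => Finset.sum_nonneg fun j _ => by split_ifs <;> norm_num
  -- the best policy plays the hidden actions; its action in the absorbing state is irrelevant
  let π' : Policy (Fin (m + 1)) (Fin K) (n + 1) :=
    fun x => Fin.cases (θ (x.2, 0)) (fun j => θ (x.2, j)) x.1
  have hbest : (1 - δ / 2 + δ * ε) ^ (n + 1) ≤
      (tabularTask P).bestMean (boundedHardMDP ε fun i => some (θ i)) () := by
    have h1 : (tabularTask P).mean (boundedHardMDP ε fun i => some (θ i)) π' () ≤
        (tabularTask P).bestMean (boundedHardMDP ε fun i => some (θ i)) () :=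
      le_ciSup (f := fun d => (tabularTask P).mean (boundedHardMDP ε fun i => some (θ i)) d ())
        (Set.finite_range _).bddAbove π'
    refine le_trans (le_of_eq ?_) h1
    have h2 : ∀ h, MDP.meanSurvival ε (fun i => some (θ i)) π' h = 1 - δ / 2 + δ * ε := fun h => by
      simp only [MDP.meanSurvival, hs]
      simp [π']
      field_simp
    rw [tabularTask_mean]
    simp [h2]
  refine le_trans ?_ (sub_le_sub_right hbest _)
  rw [tabularTask_mean]
  have hprod := pow_sub_prod_ge (Finset.univ : Finset (Fin (n + 1))) (a := 1 - δ / 2 + δ * ε)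
    (c := 1 - δ / 2) (by linarith) (by linarith) (by linarith) b
    (fun h => by
      have : δ * ε / m * ∑ j : Fin m, (if π (j.succ, h) ≠ θ (h, j) then (1 : ℝ) else 0) ≤
          δ * ε := by
        calc _ ≤ δ * ε / m * m := mul_le_mul_of_nonneg_left (hcount h) (by positivity)
          _ = δ * ε := by field_simp
      rw [hbs]; linarith)
    (fun h => by
      have : 0 ≤ δ * ε / m * ∑ j : Fin m, (if π (j.succ, h) ≠ θ (h, j) then (1 : ℝ) else 0) :=
        mul_nonneg (by positivity) (hcount0 h)
      rw [hbs]; linarith)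
  rw [Finset.card_univ, Fintype.card_fin] at hprod
  refine le_trans ?_ hprod
  -- Bernoulli's inequality: survival with ordinary actions has probability at least `1 / 2`
  have hhalf : 1 / 2 ≤ (1 - δ / 2) ^ (n + 1) := by
    have := one_add_mul_le_pow (a := -(δ / 2)) (by linarith) (n + 1)
    have e : 1 + ((n + 1 : ℕ) : ℝ) * -(δ / 2) = 1 / 2 := by
      rw [hδ]; push_cast; field_simp; norm_num
    rw [e] at this
    exact this
  have hsum : ∑ h, (1 - δ / 2 + δ * ε - b h) = δ * ε / m *
      ∑ i : Fin (n + 1) × Fin m, (if π (i.2.succ, i.1) ≠ θ i then (1 : ℝ) else 0) := by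
    rw [Fintype.sum_prod_type, Finset.mul_sum]
    refine Finset.sum_congr rfl fun h _ => ?_
    rw [hbs]; ring
  rw [hsum]
  have h0 : 0 ≤ δ * ε / m *
      ∑ i : Fin (n + 1) × Fin m, (if π (i.2.succ, i.1) ≠ θ i then (1 : ℝ) else 0) :=
    mul_nonneg (by positivity) (Finset.sum_nonneg fun j _ => by split_ifs <;> norm_num)
  refine le_trans (le_of_eq ?_) (mul_le_mul_of_nonneg_right hhalf h0)
  field_simp

theorem exists_prior_tabularTask (n m K T : ℕ) [NeZero m] (hK : 2 ≤ K)
    (hT : (n + 1) * (m + 1) * K ≤ T) :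
    ∃ P : ProbabilityMeasure (BoundedMDP (Fin (m + 1)) (Fin K) (n + 1) × Unit),
      ∀ alg : Algorithm (Policy (Fin (m + 1)) (Fin K) (n + 1)) Unit
          (Fin (n + 1) → Stage (Fin (m + 1)) (Fin K)),
        1 / 120 * √(((n + 1 : ℕ) : ℝ) * (m + 1 : ℕ) * K * T) ≤
          (tabularTask P).bayesRegret alg T := by
  have hm1 : 1 ≤ m := Nat.pos_of_neZero m
  have hm : (1 : ℝ) ≤ m := by exact_mod_cast hm1
  have : Nonempty (Fin K) := ⟨⟨0, by omega⟩⟩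
  have hKr : (2 : ℝ) ≤ K := by exact_mod_cast hK
  have hNT : ((n : ℝ) + 1) * m * K ≤ T := by
    have h1 : (n + 1) * m * K ≤ T :=
      le_trans (by gcongr; omega) hT
    exact_mod_cast h1
  obtain ⟨ε, hε, hε', h1, h2⟩ := exists_gap (N := ((n : ℝ) + 1) * m * K) (T := T)
    (by positivity) hNT
  let P : ProbabilityMeasure (BoundedMDP (Fin (m + 1)) (Fin K) (n + 1) × Unit) :=
    ⟨uniformLaw fun θ : Fin (n + 1) × Fin m → Fin K =>
      (boundedHardMDP ε fun i => some (θ i), ()), inferInstance⟩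
  refine ⟨P, fun alg => ?_⟩
  have key := (tabularTask P).le_bayesRegret_of_uniform alg (T := T)
    (I := Fin (n + 1) × Fin m) (A := Fin K)
    (boundedHardMDP ε) (fun π i => π (i.2.succ, i.1))
    (η := 6 * (1 / ((n : ℝ) + 1)) * ε ^ 2 / m) (ρ := 1 / ((n : ℝ) + 1) * ε / (2 * m))
    (by positivity) (by positivity)
    (map_uniformLaw _ measurable_fst) ?_ (gap_hardMDP hε hε' P) (by simpa using hK) ?_
  · refine le_trans ?_ key
    have e : 1 / ((n : ℝ) + 1) * ε / (2 * m) * Fintype.card (Fin (n + 1) × Fin m) * T / 8 =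
        ε * T / 16 := by
      rw [Fintype.card_prod, Fintype.card_fin, Fintype.card_fin]
      push_cast
      field_simp
      ring
    rw [e, h2]
    -- the number of states is at most twice the number of live states
    have h3 : √(((n + 1 : ℕ) : ℝ) * (m + 1 : ℕ) * K * T) ≤
        3 / 2 * √(((n : ℝ) + 1) * m * K * T) := by
      rw [show (3 / 2 : ℝ) = √(9 / 4) by
        rw [show (9 / 4 : ℝ) = (3 / 2) ^ 2 by norm_num, Real.sqrt_sq (by norm_num)],
        ← Real.sqrt_mul (by norm_num)]
      refine Real.sqrt_le_sqrt ?_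
      have h4 : ((m : ℝ) + 1) ≤ 9 / 4 * m := by linarith
      calc ((n + 1 : ℕ) : ℝ) * (m + 1 : ℕ) * K * T
          = ((n : ℝ) + 1) * K * T * ((m : ℝ) + 1) := by push_cast; ring
        _ ≤ ((n : ℝ) + 1) * K * T * (9 / 4 * m) := by gcongr
        _ = _ := by ring
    linarith
  · intro θ i a hθ π
    rw [tabularTask_feedback, tabularTask_feedback]
    have := MDP.isMarkovKernel_episodeKernel (S := Fin (m + 1)) (A := Fin K) (H := n + 1)
    refine (klDiv_map_le _ _ (measurable_id.prodMk measurable_totalReward)).trans ?_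
    refine (MDP.klDiv_episodeKernel_le hε hε' θ i a hθ π).trans (le_of_eq ?_)
    by_cases ha : π (i.2.succ, i.1) = a <;> simp [ha]
  · have e : 6 * (1 / ((n : ℝ) + 1)) * ε ^ 2 / m * T =
        6 * (1 / ((n : ℝ) + 1)) / m * (ε ^ 2 * T) := by ring
    rw [e, h1, Fintype.card_fin]
    have : 6 * (1 / ((n : ℝ) + 1)) / m * (((n : ℝ) + 1) * m * K / 25) = 6 / 25 * K := by
      field_simp
    rw [this]
    linarith

end Tabular

end InteractiveDecision

end

theorem mainTheorem7 :
    ∃ c : ℝ, 0 < c ∧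
      -- finite decision sets, single context, observed rewards
      (∀ (Dec : Type) [Fintype Dec] [MeasurableSpace Dec] [MeasurableSingletonClass Dec] (T : ℕ),
        2 ≤ Fintype.card Dec → Fintype.card Dec ≤ T →
        ∃ (Obs Model : Type) (_ : MeasurableSpace Obs) (_ : TopologicalSpace Model)
          (_ : CompactSpace Model) (_ : T2Space Model) (_ : MeasurableSpace Model)
          (_ : BorelSpace Model) (task : Task Dec Unit Obs Model),
          task.RewardObserved ∧ ∀ alg : Algorithm Dec Unit Obs,
            c * √((Fintype.card Dec : ℝ) * T) ≤ task.bayesRegret alg T) ∧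
      -- multi-armed bandits with `K` arms
      (∀ K T : ℕ, 2 ≤ K → K ≤ T →
        ∃ P : ProbabilityMeasure (((Fin K × Unit) → unitInterval) × Unit),
          ∀ alg : Algorithm (Fin K) Unit ℝ,
            c * √((K : ℝ) * T) ≤ (banditTask P).bayesRegret alg T) ∧
      -- tabular reinforcement learning with `S` states, `K` actions and horizon `H`
      (∀ H S K T : ℕ, 1 ≤ H → 2 ≤ S → 2 ≤ K → H * S * K ≤ T →
        ∃ P : ProbabilityMeasure (BoundedMDP (Fin S) (Fin K) H × Unit),
          ∀ alg : Algorithm (Policy (Fin S) (Fin K) H) Unit (Fin H → Stage (Fin S) (Fin K)),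
            c * √((H : ℝ) * S * K * T) ≤ (tabularTask P).bayesRegret alg T) := by
  classical
  refine ⟨1 / 120, by norm_num, ?_, ?_, ?_⟩
  · intro Dec _ _ _ T hK hT
    obtain ⟨P, hP⟩ := exists_prior_banditTask (Dec := Dec) T hK hT
    refine ⟨ℝ, (Dec × Unit) → unitInterval, inferInstance, inferInstance, inferInstance,
      inferInstance, inferInstance, inferInstance, banditTask P, ⟨id, measurable_id, fun x => ?_⟩,
      hP⟩
    simp only [id]
    rw [banditTask_feedback, ae_map_iff (by fun_prop)
      (measurableSet_eq_fun measurable_snd measurable_fst)]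
    exact ae_of_all _ fun _ => rfl
  · intro K T hK hT
    simpa using exists_prior_banditTask (Dec := Fin K) T (by simpa using hK) (by simpa using hT)
  · intro H S K T hH hS hK hT
    obtain ⟨n, rfl⟩ : ∃ n, H = n + 1 := ⟨H - 1, by omega⟩
    obtain ⟨m, rfl⟩ : ∃ m, S = m + 1 := ⟨S - 1, by omega⟩
    have : NeZero m := ⟨by omega⟩
    exact exists_prior_tabularTask n m K T hK hT
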